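/- **Setting.** Let $Y=m(X,\theta_0)+\varepsilon$ and $W=X+U$, where $X$ is a random vector in $\mathbb R^p$, $\theta_0\in\Theta\subset\mathbb R^q$, $\varepsilon$ has conditional density $g(\cdot\mid X=x)$ given $X=x$ (jointly measurable), the marginal density of $\varepsilon$ has a unique mode at $0$, and $U\sim N_p(0,\Sigma_u)$ is independent of $(X,\varepsilon)$ with $\Sigma_u$ positive definite. Let $(X_i,\varepsilon_i,U_i)$, $i\ge1$, be i.i.d. copies of $(X,\varepsilon,U)$, $Y_i=m(X_i,\theta_0)+\varepsilon_i$, and let $V_{ib}$, $i\ge 1$, $1\le b\le B$ ($B\ge1$ fixed), be i.i.d. $N_p(0,\Sigma_u)$, independent of the data. Fix $\lambda\ge0$ and put $W_{ib}(\lambda)=X_i+U_i+\sqrt\lambda V_{ib}$; $W(\lambda)=X+U+\sqrt\lambda V$ is its generic version. Let $K$ be the standard normal density, $K_h(t)=h^{-1}K(t/h)$, $h=h_n>0$, and $$Q_n(\theta,\lambda)=\frac1{nh}\sum_{i=1}^nK\Big(\frac{Y_i-m(W_{ib}(\lambda),\theta)}h\Big),\qquad \theta(\lambda,h)=\arg\max_{\theta\in\Theta}EK_h(Y-m(W(\lambda),\theta)).$$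 Let $\theta(\lambda)$ be the maximizer over $\Theta$ of $\lim_{h\downarrow0}EK_h(Y-m(W(\lambda),\theta))$; it is assumed to exist, to lie in the interior of $\Theta$ and to be unique and well separated (for each $r>0$ the supremum of the limit over $\{\theta\in\Theta:\|\theta-\theta(\lambda)\|\ge r\}$ is strictly smaller than its maximum; for compact $\Theta$ and a continuous limit this is just uniqueness). Dots denote derivatives in $\theta$, and primes on $g$ derivatives in its first argument. **Conditions.** * **C1.** $\theta\mapsto m(x,\theta)$ is three times continuously differentiable in the interior of $\Theta$, and $x\mapsto m(x,\theta)$ is continuously differentiable. * **C2.** For each $\theta\in\Theta$, $t\mapsto E[g(t+m(W(\lambda),\theta)-m(X,\theta_0)\mid X)\mid W(\lambda)]$ has continuous derivatives up to order three, bounded (almost surely, by a constant independent of $t$ and of the value of $W(\lambda)$), and $E\|\dot m(W(\lambda),\theta(\lambda))\,g'(m(W(\lambda),\theta(\lambda))-m(X,\theta_0)\mid X)\|^2<\infty$. * **C3.** For almost every $x$ (with respect to the law of $X$): $g'(0\mid X=x)=0$, $g''(0\mid X=x)<0$, and $g^{(k)}(\cdot\mid X=x)$ is continuous and bounded for $k=0,1,2,3$.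 Moreover $\frac{\partial^2}{\partial\theta\partial\theta^T}E[g(m(W(\lambda),\theta)-m(X,\theta_0)\mid X)]$ at $\theta=\theta(\lambda)$ is negative definite. * **C4.** For all sufficiently large $n$ the maximizer $\theta(\lambda,h)$ exists, is unique, and solves $E\big[\partial K_h(Y-m(W(\lambda),\theta))/\partial\theta\big]=\partial EK_h(Y-m(W(\lambda),\theta))/\partial\theta=0$. * **C5.** $h\to0$ and $nh^5\to\infty$ as $n\to\infty$. * **Local domination.** There are a neighbourhood $N$ of $\theta(\lambda)$ and a function $G$ with $EG(W(\lambda))<\infty$ such that $\|\dot m(w,\theta)\|^2\le G(w)$ and $\|\ddot m(w,\theta)\|\le G(w)$ for all $w\in\mathbb R^p$, $\theta\in N$. **Theorem 2.** Under these conditions, for each $b=1,\dots,B$ there are random vectors $\hat\theta_b(\lambda)=\hat\theta_{b,n}(\lambda)$ which, with probability tending to $1$ as $n\to\infty$, lie in $\Theta$ and are local maximizers of $\theta\mapsto Q_n(\theta,\lambda)$ (formed with the $b$-th simulated set), such that $$\|\hat\theta_b(\lambda)-\theta(\lambda,h)\|=O_p(a_n),\qquad a_n=h^2+(nh^3)^{-1/2}.$$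 The SIMEX average $\hat\theta(\lambda)=B^{-1}\sum_{b=1}^B\hat\theta_b(\lambda)$ satisfies $\|\hat\theta(\lambda)-\theta(\lambda,h)\|=O_p(a_n)$ as well. -/

import Mathlib

open MeasureTheory ProbabilityTheory Filter Topology
open scoped ENNReal

noncomputable section

namespace SimexModal

/-- `d`-dimensional Euclidean space. -/
abbrev E (d : ℕ) : Type := EuclideanSpace ℝ (Fin d)

/-- The parametric modal regression model `Y = m(X, θ₀) + ε`, `W = X + U`, with
`U ∼ N_p(0, Σ_u)` independent of `(X, ε)`; `g x` is the density of `ε` given `X = x`. -/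
structure Model (p q : ℕ) where
  /-- the regression function `m(x, θ)` -/
  m : E p → E q → ℝ
  /-- the parameter set -/
  Θ : Set (E q)
  /-- the true parameter -/
  θ₀ : E q
  θ₀_mem : θ₀ ∈ Θ
  /-- the law of the true predictor `X` -/
  ν : Measure (E p)
  prob_ν : IsProbabilityMeasure ν
  /-- the conditional density `g(· | X = x)` of `ε` -/
  g : E p → ℝ → ℝ
  measurable_g : Measurable (Function.uncurry g)
  g_nonneg : ∀ x e, 0 ≤ g x e
  lintegral_g : ∀ x, ∫⁻ e, ENNReal.ofReal (g x e) = 1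
  /-- the marginal density of `ε` has a unique mode at `0` -/
  mode : ∀ t : ℝ, t ≠ 0 →
    ∫⁻ x, ENNReal.ofReal (g x t) ∂ν < ∫⁻ x, ENNReal.ofReal (g x 0) ∂ν
  /-- the covariance matrix `Σ_u` of the measurement error -/
  Su : Matrix (Fin p) (Fin p) ℝ
  posDef_Su : Su.PosDef

namespace Model

/-- The law of `(X, ε)`. -/
def lawXe {p q : ℕ} (M : Model p q) : Measure (E p × ℝ) :=
  (M.ν.prod volume).withDensity (fun z => ENNReal.ofReal (M.g z.1 z.2))

instance instProbLawXe {p q : ℕ} (M : Model p q) : IsProbabilityMeasure M.lawXe := by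
  have := M.prob_ν
  constructor
  have hm : Measurable (fun z : E p × ℝ => ENNReal.ofReal (M.g z.1 z.2)) :=
    M.measurable_g.ennreal_ofReal
  rw [lawXe, withDensity_apply _ MeasurableSet.univ, Measure.restrict_univ,
    lintegral_prod _ hm.aemeasurable]
  simp [M.lintegral_g]

/-- The law `N_p(0, Σ_u)`. -/
def noise {p q : ℕ} (M : Model p q) : Measure (E p) := multivariateGaussian 0 M.Su

instance instProbNoise {p q : ℕ} (M : Model p q) : IsProbabilityMeasure M.noise := by
  unfold noise; infer_instance

/-- The joint law of `((X, ε), U, V)`, where `V ∼ N_p(0, Σ_u)` is the simulated error. -/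
def popLaw {p q : ℕ} (M : Model p q) : Measure ((E p × ℝ) × E p × E p) :=
  M.lawXe.prod (M.noise.prod M.noise)

instance instProbPopLaw {p q : ℕ} (M : Model p q) : IsProbabilityMeasure M.popLaw := by
  unfold popLaw; infer_instance

end Model

/-- The coordinate `X` of `z = ((X, ε), U, V)`. -/
def Xv {p : ℕ} (z : (E p × ℝ) × E p × E p) : E p := z.1.1

/-- The coordinate `W(lam) = X + U + √lam V`. -/
def Wv {p : ℕ} (lam : ℝ) (z : (E p × ℝ) × E p × E p) : E p :=
  z.1.1 + z.2.1 + Real.sqrt lam • z.2.2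

/-- The response `Y = m(X, θ₀) + ε`. -/
def Yv {p q : ℕ} (M : Model p q) (z : (E p × ℝ) × E p × E p) : ℝ :=
  M.m z.1.1 M.θ₀ + z.1.2

/-- `K_h(t) = h⁻¹ K(t / h)` with `K` the standard normal density. -/
def Kh (h t : ℝ) : ℝ := h⁻¹ * gaussianPDFReal 0 1 (t / h)

/-- The population objective `E K_h(Y - m(W(lam), θ))`. -/
def popObj {p q : ℕ} (M : Model p q) (lam h : ℝ) (θ : E q) : ℝ :=
  ∫ z, Kh h (Yv M z - M.m (Wv lam z) θ) ∂M.popLaw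

/-- `E[g(t + m(W(lam), θ) - m(X, θ₀) | X) | W(lam) = w]`, the conditional density at `t` of
`Y - m(W(lam), θ)` given `W(lam) = w`. -/
def condDens {p q : ℕ} (M : Model p q) (lam : ℝ) (θ : E q) (w : E p) (t : ℝ) : ℝ :=
  ∫ x, M.g x (t + M.m w θ - M.m x M.θ₀) ∂(condDistrib Xv (Wv lam) M.popLaw w)

/-- `E[g(m(W(lam), θ) - m(X, θ₀) | X)]`. -/
def meanDens {p q : ℕ} (M : Model p q) (lam : ℝ) (θ : E q) : ℝ :=
  ∫ z, M.g (Xv z) (M.m (Wv lam z) θ - M.m (Xv z) M.θ₀) ∂M.popLaw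

/-- `θl` is `θ(lam) = argmax_θ lim_{h → 0} E K_h(Y - m(W(lam), θ))`: the limit exists on `Θ`, and
`θl` is an interior point of `Θ` which is its unique, well-separated maximizer. -/
def IsLimitArgmax {p q : ℕ} (M : Model p q) (lam : ℝ) (θl : E q) : Prop :=
  θl ∈ interior M.Θ ∧
  ∃ Q : E q → ℝ,
    (∀ θ ∈ M.Θ, Tendsto (fun h => popObj M lam h θ) (𝓝[>] 0) (𝓝 (Q θ))) ∧
    ∀ r > 0, ∃ δ > 0, ∀ θ ∈ M.Θ, r ≤ ‖θ - θl‖ → Q θ ≤ Q θl - δ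

/-- C1: `m` is `C³` in `θ` and `C¹` in `x`. -/
def C1 {p q : ℕ} (M : Model p q) : Prop :=
  (∀ x, ContDiffOn ℝ 3 (M.m x) (interior M.Θ)) ∧
  ∀ θ ∈ M.Θ, ContDiff ℝ 1 (fun x => M.m x θ)

/-- C2, at a fixed `lam`; the derivatives are in `t`. -/
def C2 {p q : ℕ} (M : Model p q) (lam : ℝ) (θl : E q) : Prop :=
  (∀ θ ∈ M.Θ, ∃ C : ℝ, ∀ᵐ w ∂(M.popLaw.map (Wv lam)),
    (∀ t, Integrable (fun x => M.g x (t + M.m w θ - M.m x M.θ₀))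
      (condDistrib Xv (Wv lam) M.popLaw w)) ∧
    ContDiff ℝ 3 (condDens M lam θ w) ∧
    ∀ k ≤ 3, ∀ t, |iteratedDeriv k (condDens M lam θ w) t| ≤ C) ∧
  Integrable (fun z => ‖deriv (M.g (Xv z)) (M.m (Wv lam z) θl - M.m (Xv z) M.θ₀) •
    gradient (M.m (Wv lam z)) θl‖ ^ 2) M.popLaw

/-- C3, at a fixed `lam`. -/
def C3 {p q : ℕ} (M : Model p q) (lam : ℝ) (θl : E q) : Prop :=
  (∀ᵐ x ∂M.ν, ContDiff ℝ 3 (M.g x) ∧ deriv (M.g x) 0 = 0 ∧ iteratedDeriv 2 (M.g x) 0 < 0 ∧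
    ∀ k ≤ 3, ∃ C : ℝ, ∀ e, |iteratedDeriv k (M.g x) e| ≤ C) ∧
  ∀ v : E q, v ≠ 0 → fderiv ℝ (fderiv ℝ (meanDens M lam)) θl v v < 0

/-- C4, at a fixed `lam` along the bandwidths `h n`: eventually `θh (h n)` is `θ(lam, h n)`, the
unique maximizer of the population objective, and it solves
`E[∂K_h(Y - m(W(lam), θ))/∂θ] = ∂E K_h(Y - m(W(lam), θ))/∂θ = 0`. -/
def C4 {p q : ℕ} (M : Model p q) (lam : ℝ) (h : ℕ → ℝ) (θh : ℝ → E q) : Prop :=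
  ∀ᶠ n in atTop,
    θh (h n) ∈ M.Θ ∧
    (∀ θ ∈ M.Θ, θ ≠ θh (h n) → popObj M lam (h n) θ < popObj M lam (h n) (θh (h n))) ∧
    Integrable (fun z => gradient (fun θ => Kh (h n) (Yv M z - M.m (Wv lam z) θ)) (θh (h n)))
      M.popLaw ∧
    ∫ z, gradient (fun θ => Kh (h n) (Yv M z - M.m (Wv lam z) θ)) (θh (h n)) ∂M.popLaw = 0 ∧
    HasGradientAt (popObj M lam (h n)) 0 (θh (h n))

/-- C5: the bandwidths are positive, `h → 0` and `n h⁵ → ∞`. -/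
def C5 (h : ℕ → ℝ) : Prop :=
  (∀ n, 0 < h n) ∧ Tendsto h atTop (𝓝 0) ∧ Tendsto (fun n : ℕ => (n : ℝ) * h n ^ 5) atTop atTop

/-- Local domination: near `θl`, `‖∂m/∂θ‖²` and `‖∂²m/∂θ∂θᵀ‖` at `(W(lam), θ)` are bounded by an
integrable function of `W(lam)`. -/
def LocallyDominated {p q : ℕ} (M : Model p q) (lam : ℝ) (θl : E q) : Prop :=
  ∃ r > 0, ∃ G : E p → ℝ, Integrable (fun z => G (Wv lam z)) M.popLaw ∧
    ∀ w, ∀ θ ∈ Metric.ball θl r,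
      ‖fderiv ℝ (M.m w) θ‖ ^ 2 ≤ G w ∧ ‖fderiv ℝ (fderiv ℝ (M.m w)) θ‖ ≤ G w

/-- The data and simulated errors: the vectors `((X_i, ε_i), U_i, (V_{ib})_b)` are i.i.d. over `i`,
`(X_i, ε_i)` follows the model, and `(X_i, ε_i)`, `U_i`, `V_{i1}, …, V_{iB}` are independent with
`U_i, V_{ib} ∼ N_p(0, Σ_u)`. -/
structure IsSample {p q B : ℕ} (M : Model p q) {Ω : Type*} [MeasurableSpace Ω] (P : Measure Ω)
    (X : ℕ → Ω → E p) (ε : ℕ → Ω → ℝ) (U : ℕ → Ω → E p) (V : ℕ → Fin B → Ω → E p) : Prop where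
  measurable_X : ∀ i, Measurable (X i)
  measurable_ε : ∀ i, Measurable (ε i)
  measurable_U : ∀ i, Measurable (U i)
  measurable_V : ∀ i b, Measurable (V i b)
  indep : iIndepFun (fun i ω => ((X i ω, ε i ω), U i ω, fun b => V i b ω)) P
  law : ∀ i, P.map (fun ω => ((X i ω, ε i ω), U i ω, fun b => V i b ω)) =
    M.lawXe.prod (M.noise.prod (Measure.pi fun _ : Fin B => M.noise))

/-- `Q_n(θ, lam) = (n h)⁻¹ ∑_{i ≤ n} K((Y_i - m(W_{ib}(lam), θ)) / h)` for the `b`-th simulated set,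
where `Y_i = m(X_i, θ₀) + ε_i` and `W_{ib}(lam) = X_i + U_i + √lam V_{ib}`. -/
def Qn {p q B : ℕ} (M : Model p q) {Ω : Type*}
    (X : ℕ → Ω → E p) (ε : ℕ → Ω → ℝ) (U : ℕ → Ω → E p) (V : ℕ → Fin B → Ω → E p)
    (lam h : ℝ) (n : ℕ) (b : Fin B) (ω : Ω) (θ : E q) : ℝ :=
  1 / ((n : ℝ) * h) * ∑ i ∈ Finset.range n, gaussianPDFReal 0 1
    ((M.m (X i ω) M.θ₀ + ε i ω - M.m (X i ω + U i ω + Real.sqrt lam • V i b ω) θ) / h)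

/-- `R_n = O_p(a_n)`. -/
def IsBigOInProb {Ω : Type*} [MeasurableSpace Ω] (P : Measure Ω) (R : ℕ → Ω → ℝ)
    (a : ℕ → ℝ) : Prop :=
  ∀ η : ℝ, 0 < η → ∃ C : ℝ, ∀ᶠ n in atTop, P {ω | C * a n < |R n ω|} ≤ ENNReal.ofReal η

end SimexModal

end

/-! The argument is the rate theorem for M-estimators: a quadratic drop of the population objective
around its maximizer is played against the fluctuations of the empirical objective. Since the target
is `θ(lam, h)` and not `θ(lam)`, no smoothing bias enters the comparison.

Curvature. Conditionally on `W(lam)`, the response has a smooth bounded density `respDens`, and the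
substitution `s = m + h u` turns `E K_h(Y - m(W, θ))` into `smoothObj`, an average of that density
at `m(W, θ) + h ξ` with `ξ` standard normal. In this form `h = 0` is not singular: the Hessian in
`θ` is continuous in `(h, θ)` at `(0, θl)`, where C3 makes it negative definite. Well-separation
brings `θ(lam, h)` close to `θl`, and C4 makes it a critical point, so the objective falls below its
value there by at least `c ‖θ - θ(lam, h)‖²`, with `c` independent of `h` (`exists_popObj_drop`).

Fluctuations. A summand increment is at most `h⁻¹` in absolute value, and its second moment is
`O(h⁻³ ‖θ - θ'‖²)`, because translations of `K_h` are Lipschitz in `L²` with constant `h ^ (-3/2)`.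
Bernstein's inequality and chaining bound the centred increments over a ball of radius `s ≥ a` by a
multiple of `s * a`, as soon as `n h³ a² ≥ 1` and `h² ≤ a` (`GoodBall.exists_shell_const`). The
second condition pays only for the scales where the chaining stops and a crude Lipschitz bound takes
over.

Conclusion. On the dyadic shell of radius `s` the drop is of order `s²` and the fluctuation of order
`s * a`, so a maximizer is unlikely to lie in a shell with `s` much larger than `a`
(`GoodBall.exists_rate`). The estimator is a measurable maximizer over a fixed small closed ball; by
the rate it lies inside the open ball with probability tending to one, hence is a local maximizer.
-/

namespace SimexModal

/-! ### Conditional density of the response and the smoothed objective. -/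

section

variable {p q : ℕ}

lemma measurable_Xv : Measurable (Xv (p := p)) := by unfold Xv; fun_prop

lemma measurable_Wv (lam : ℝ) : Measurable (Wv (p := p) lam) := by unfold Wv; fun_prop

lemma measurable_regression {M : Model p q} (h1 : C1 M) {θ : E q} (hθ : θ ∈ M.Θ) :
    Measurable fun x => M.m x θ := (h1.2 θ hθ).continuous.measurable

lemma measurable_Yv {M : Model p q} (h1 : C1 M) : Measurable (Yv M) := by
  have := measurable_regression h1 M.θ₀_mem
  unfold Yv; fun_prop

/-- The conditional density of the response `Y` given `W(lam) = w`. -/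
noncomputable def respDens (M : Model p q) (lam : ℝ) (w : E p) (s : ℝ) : ℝ :=
  ∫ x, M.g x (s - M.m x M.θ₀) ∂(condDistrib Xv (Wv lam) M.popLaw w)

/-- For fixed `w` the conditional densities are translates of one function that does not involve
`θ`, so regularity at a single parameter gives it at all parameters with the same constant. -/
lemma condDens_eq (M : Model p q) (lam : ℝ) (θ : E q) (w : E p) :
    condDens M lam θ w = fun t => respDens M lam w (t + M.m w θ) := rfl

lemma respDens_nonneg (M : Model p q) (lam : ℝ) (w : E p) (s : ℝ) : 0 ≤ respDens M lam w s :=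
  integral_nonneg fun _ => M.g_nonneg _ _

lemma measurable_respDens {M : Model p q} (h1 : C1 M) (lam : ℝ) :
    Measurable (Function.uncurry (respDens M lam)) := by
  have hm := measurable_regression h1 M.θ₀_mem
  have hg := M.measurable_g
  let κ : Kernel (E p × ℝ) (E p) :=
    (condDistrib Xv (Wv lam) M.popLaw).comap Prod.fst measurable_fst
  have h : StronglyMeasurable (fun a : (E p × ℝ) × E p => M.g a.2 (a.1.2 - M.m a.2 M.θ₀)) := by
    refine Measurable.stronglyMeasurable ?_
    exact hg.comp (f := fun a : (E p × ℝ) × E p => (a.2, a.1.2 - M.m a.2 M.θ₀)) (by fun_prop)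
  exact (h.integral_kernel_prod_right' (κ := κ)).measurable

/-- Disintegration of `(W(lam), X)` along `W(lam)`. -/
lemma lintegral_condDistrib (M : Model p q) (lam : ℝ) {f : E p → E p → ℝ≥0∞}
    (hf : Measurable (Function.uncurry f)) :
    ∫⁻ z, f (Wv lam z) (Xv z) ∂M.popLaw =
      ∫⁻ z, ∫⁻ x, f (Wv lam z) x ∂(condDistrib Xv (Wv lam) M.popLaw (Wv lam z)) ∂M.popLaw := by
  have hW := measurable_Wv (p := p) lam
  have hX := measurable_Xv (p := p)
  have h := compProd_map_condDistrib (μ := M.popLaw) (X := Wv (p := p) lam) (Y := Xv (p := p))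
    (mβ := inferInstance) hX.aemeasurable
  have h' := congrArg (fun μ => ∫⁻ a, Function.uncurry f a ∂μ) h
  simp only at h'
  rw [Measure.lintegral_compProd hf, lintegral_map hf (by fun_prop)] at h'
  simp only [Function.uncurry_apply_pair] at h'
  rw [lintegral_map (Measurable.lintegral_kernel_prod_right hf) hW] at h'
  exact h'.symm

/-- Under the model, `(W(lam), Y)` has density `g(s - m(X, θ₀) | X)` given `(X, U, V)`. -/
lemma lintegral_resp_aux {M : Model p q} (h1 : C1 M) (lam : ℝ) {φ : E p → ℝ → ℝ≥0∞}
    (hφ : Measurable (Function.uncurry φ)) :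
    ∫⁻ z, φ (Wv lam z) (Yv M z) ∂M.popLaw =
      ∫⁻ z, (∫⁻ s, φ (Wv lam z) s * ENNReal.ofReal (M.g (Xv z) (s - M.m (Xv z) M.θ₀)))
        ∂M.popLaw := by
  have := M.prob_ν
  have hm := measurable_regression h1 M.θ₀_mem
  have hY := measurable_Yv h1
  have hW := measurable_Wv (p := p) lam
  have hX := measurable_Xv (p := p)
  have hg := M.measurable_g.ennreal_ofReal
  have hg' : Measurable (fun z : E p × ℝ => ENNReal.ofReal (M.g z.1 z.2)) := hg
  -- integrate out the noise first
  have key : ∀ ψ : (E p × ℝ) × E p × E p → ℝ≥0∞, Measurable ψ →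
      ∫⁻ z, ψ z ∂M.popLaw = ∫⁻ x, ∫⁻ v, (∫⁻ e, ψ ((x, e), v) * ENNReal.ofReal (M.g x e))
        ∂(M.noise.prod M.noise) ∂M.ν := by
    intro ψ hψ
    rw [Model.popLaw, lintegral_prod _ hψ.aemeasurable, Model.lawXe,
      lintegral_withDensity_eq_lintegral_mul _ hg' hψ.lintegral_prod_right',
      lintegral_prod _ (by
        have := hψ.lintegral_prod_right' (ν := M.noise.prod M.noise)
        exact (hg'.mul this).aemeasurable)]
    refine lintegral_congr fun x => ?_
    simp only [Pi.mul_apply]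
    have h2 : ∀ e, ENNReal.ofReal (M.g x e) * ∫⁻ v, ψ ((x, e), v) ∂(M.noise.prod M.noise) =
        ∫⁻ v, ψ ((x, e), v) * ENNReal.ofReal (M.g x e) ∂(M.noise.prod M.noise) := by
      intro e
      rw [mul_comm, lintegral_mul_const]
      fun_prop
    simp_rw [h2]
    rw [lintegral_lintegral_swap]
    have : Measurable fun a : ℝ × E p × E p => ENNReal.ofReal (M.g x a.1) :=
      hg'.comp (f := fun a : ℝ × E p × E p => (x, a.1)) (by fun_prop)
    refine Measurable.aemeasurable ?_
    exact Measurable.mul (by fun_prop) this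
  have hL : Measurable fun z => φ (Wv lam z) (Yv M z) :=
    hφ.comp (f := fun z => (Wv lam z, Yv M z)) (by fun_prop)
  have hG : Measurable fun a : ((E p × ℝ) × E p × E p) × ℝ =>
      φ (Wv lam a.1) a.2 * ENNReal.ofReal (M.g (Xv a.1) (a.2 - M.m (Xv a.1) M.θ₀)) := by
    refine Measurable.mul (hφ.comp (f := fun a : ((E p × ℝ) × E p × E p) × ℝ =>
      (Wv lam a.1, a.2)) (by fun_prop)) ?_
    exact hg'.comp (f := fun a : ((E p × ℝ) × E p × E p) × ℝ =>
      (Xv a.1, (a.2 - M.m (Xv a.1) M.θ₀))) (by fun_prop)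
  rw [key _ hL, key _ hG.lintegral_prod_right']
  refine lintegral_congr fun x => lintegral_congr fun v => ?_
  -- `W(lam)` does not involve `ε`, so for fixed `X`, `U`, `V` the right-hand integrand is constant
  -- in `e` against a density of mass one; on the left the translation by `m(x, θ₀)` turns `e` into
  -- the response.
  have e1 : ∀ e, Wv lam ((x, e), v) = Wv lam ((x, 0), v) := fun e => rfl
  simp only [e1, Xv, Yv]
  rw [lintegral_const_mul]
  · rw [M.lintegral_g, mul_one]
    rw [← lintegral_sub_right_eq_self _ (M.m x M.θ₀)]
    simp
  · exact hg'.comp (f := fun e => (x, e)) (by fun_prop)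

/-- What `C2` says about the conditional density of the response. -/
def RegularDens (M : Model p q) (lam C : ℝ) : Prop :=
  ∀ᵐ z ∂M.popLaw,
    (∀ s, Integrable (fun x => M.g x (s - M.m x M.θ₀))
      (condDistrib Xv (Wv lam) M.popLaw (Wv lam z))) ∧
    ContDiff ℝ 3 (respDens M lam (Wv lam z)) ∧
    ∀ k ≤ 3, ∀ s, |iteratedDeriv k (respDens M lam (Wv lam z)) s| ≤ C

/-- C2 is applied at `θ₀` only and translated back; the resulting constant therefore serves every
`θ`. -/
lemma exists_regularDens {M : Model p q} {lam : ℝ} {θl : E q} (h2 : C2 M lam θl) :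
    ∃ C, 0 ≤ C ∧ RegularDens M lam C := by
  obtain ⟨C, hC⟩ := h2.1 M.θ₀ M.θ₀_mem
  have hC' := ae_of_ae_map (measurable_Wv lam).aemeasurable hC
  have hreg : RegularDens M lam C := by
    filter_upwards [hC'] with z ⟨hz1, hz2, hz3⟩
    have e : respDens M lam (Wv lam z) =
        fun s => condDens M lam M.θ₀ (Wv lam z) (s - M.m (Wv lam z) M.θ₀) := by
      ext s; simp [condDens_eq]
    refine ⟨fun s => ?_, ?_, fun k hk s => ?_⟩
    · simpa using hz1 (s - M.m (Wv lam z) M.θ₀)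
    · rw [e]; exact hz2.comp (contDiff_id.sub contDiff_const)
    · rw [e, iteratedDeriv_comp_sub_const]; exact hz3 k hk _
  obtain ⟨z, hz⟩ := hreg.exists
  exact ⟨C, (abs_nonneg _).trans (hz.2.2 0 (by norm_num) 0), hreg⟩

lemma RegularDens.lintegral_ofReal {M : Model p q} {lam C : ℝ} (hC : RegularDens M lam C) :
    ∀ᵐ z ∂M.popLaw, ∀ s, ∫⁻ x, ENNReal.ofReal (M.g x (s - M.m x M.θ₀))
      ∂(condDistrib Xv (Wv lam) M.popLaw (Wv lam z)) =
        ENNReal.ofReal (respDens M lam (Wv lam z) s) := by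
  filter_upwards [hC] with z hz s
  rw [respDens, ofReal_integral_eq_lintegral_ofReal (hz.1 s)]
  exact Eventually.of_forall fun _ => M.g_nonneg _ _

/-- `respDens` is the conditional density of `Y` given `W(lam)`. -/
lemma lintegral_resp {M : Model p q} (h1 : C1 M) {lam C : ℝ} (hC : RegularDens M lam C)
    {φ : E p → ℝ → ℝ≥0∞} (hφ : Measurable (Function.uncurry φ)) :
    ∫⁻ z, φ (Wv lam z) (Yv M z) ∂M.popLaw =
      ∫⁻ z, (∫⁻ s, φ (Wv lam z) s * ENNReal.ofReal (respDens M lam (Wv lam z) s)) ∂M.popLaw := by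
  have hm := measurable_regression h1 M.θ₀_mem
  have hW := measurable_Wv (p := p) lam
  have hX := measurable_Xv (p := p)
  have hg := M.measurable_g.ennreal_ofReal
  have hg' : Measurable (fun z : E p × ℝ => ENNReal.ofReal (M.g z.1 z.2)) := hg
  have hr := (measurable_respDens h1 lam).ennreal_ofReal
  rw [lintegral_resp_aux h1 lam hφ, lintegral_lintegral_swap (μ := M.popLaw)
    (f := fun z s => φ (Wv lam z) s * ENNReal.ofReal (M.g (Xv z) (s - M.m (Xv z) M.θ₀))),
    lintegral_lintegral_swap (μ := M.popLaw)
    (f := fun z s => φ (Wv lam z) s * ENNReal.ofReal (respDens M lam (Wv lam z) s))]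
  -- With `s` fixed, `X` enters only through the density, and integrating it against the conditional
  -- law given `W(lam)` produces `respDens`.
  · refine lintegral_congr fun s => ?_
    have hf : Measurable (Function.uncurry fun w x : E p =>
        φ w s * ENNReal.ofReal (M.g x (s - M.m x M.θ₀))) := by
      refine Measurable.mul (hφ.comp (f := fun a : E p × E p => (a.1, s)) (by fun_prop)) ?_
      exact hg'.comp (f := fun a : E p × E p => (a.2, s - M.m a.2 M.θ₀)) (by fun_prop)
    rw [lintegral_condDistrib M lam hf]
    refine lintegral_congr_ae ?_
    filter_upwards [hC.lintegral_ofReal] with z hz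
    have hgs : Measurable fun x => ENNReal.ofReal (M.g x (s - M.m x M.θ₀)) :=
      hg'.comp (f := fun x => (x, s - M.m x M.θ₀)) (by fun_prop)
    rw [lintegral_const_mul _ hgs, hz]
  · refine Measurable.aemeasurable (Measurable.mul ?_ ?_)
    · exact hφ.comp (f := fun a : ((E p × ℝ) × E p × E p) × ℝ => (Wv lam a.1, a.2)) (by fun_prop)
    · exact hr.comp (f := fun a : ((E p × ℝ) × E p × E p) × ℝ => (Wv lam a.1, a.2)) (by fun_prop)
  · refine Measurable.aemeasurable (Measurable.mul ?_ ?_)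
    · exact hφ.comp (f := fun a : ((E p × ℝ) × E p × E p) × ℝ => (Wv lam a.1, a.2)) (by fun_prop)
    · exact hg'.comp (f := fun a : ((E p × ℝ) × E p × E p) × ℝ =>
        (Xv a.1, a.2 - M.m (Xv a.1) M.θ₀)) (by fun_prop)

/-- The objective smoothed at bandwidth `h`, as an expectation over `(X, ε, U, V)` and an
independent standard normal variable. -/
noncomputable def smoothObj (M : Model p q) (lam h : ℝ) (θ : E q) : ℝ :=
  ∫ z, respDens M lam (Wv lam z.1) (M.m (Wv lam z.1) θ + h * z.2)
    ∂(M.popLaw.prod (gaussianReal 0 1))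

lemma measurable_respDens_comp {M : Model p q} (h1 : C1 M) (lam h : ℝ) {θ : E q}
    (hθ : θ ∈ M.Θ) : Measurable fun z : ((E p × ℝ) × E p × E p) × ℝ =>
      respDens M lam (Wv lam z.1) (M.m (Wv lam z.1) θ + h * z.2) := by
  have hm := measurable_regression h1 hθ
  have hW := measurable_Wv (p := p) lam
  exact (measurable_respDens h1 lam).comp (f := fun z : ((E p × ℝ) × E p × E p) × ℝ =>
    (Wv lam z.1, M.m (Wv lam z.1) θ + h * z.2)) (by fun_prop)

lemma smoothObj_eq_toReal {M : Model p q} (h1 : C1 M) (lam h : ℝ) {θ : E q} (hθ : θ ∈ M.Θ) :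
    smoothObj M lam h θ = (∫⁻ z, (∫⁻ u, ENNReal.ofReal (respDens M lam (Wv lam z)
      (M.m (Wv lam z) θ + h * u)) ∂gaussianReal 0 1) ∂M.popLaw).toReal := by
  have hmeas := measurable_respDens_comp h1 lam h hθ
  rw [smoothObj, integral_eq_lintegral_of_nonneg_ae
    (Eventually.of_forall fun _ => respDens_nonneg _ _ _ _) hmeas.aestronglyMeasurable,
    lintegral_prod _ hmeas.ennreal_ofReal.aemeasurable]

/-- At bandwidth zero the normal variable drops out. This places the Hessian assumption of C3 at the
`h = 0` member of the smoothed family. -/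
lemma meanDens_eq_smoothObj {M : Model p q} (h1 : C1 M) {lam C : ℝ} (hC : RegularDens M lam C)
    {θ : E q} (hθ : θ ∈ M.Θ) : meanDens M lam θ = smoothObj M lam 0 θ := by
  have hm := measurable_regression h1 hθ
  have hm0 := measurable_regression h1 M.θ₀_mem
  have hW := measurable_Wv (p := p) lam
  have hX := measurable_Xv (p := p)
  have hg : Measurable (fun z : E p × ℝ => M.g z.1 z.2) := M.measurable_g
  rw [smoothObj_eq_toReal h1 lam 0 hθ, meanDens, integral_eq_lintegral_of_nonneg_ae
    (Eventually.of_forall fun _ => M.g_nonneg _ _)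
    (hg.comp (f := fun z => (Xv z, M.m (Wv lam z) θ - M.m (Xv z) M.θ₀))
      (by fun_prop)).aestronglyMeasurable]
  congr 1
  have hf : Measurable (Function.uncurry fun w x : E p =>
      ENNReal.ofReal (M.g x (M.m w θ - M.m x M.θ₀))) :=
    (hg.comp (f := fun a : E p × E p => (a.2, M.m a.1 θ - M.m a.2 M.θ₀))
      (by fun_prop)).ennreal_ofReal
  rw [lintegral_condDistrib M lam hf]
  refine lintegral_congr_ae ?_
  filter_upwards [hC.lintegral_ofReal] with z hz
  simp [hz]

lemma popObj_eq_smoothObj {M : Model p q} (h1 : C1 M) {lam C : ℝ} (hC : RegularDens M lam C)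
    {h : ℝ} (hh : 0 < h) {θ : E q} (hθ : θ ∈ M.Θ) : popObj M lam h θ = smoothObj M lam h θ := by
  have hm := measurable_regression h1 hθ
  have hW := measurable_Wv (p := p) lam
  have hY := measurable_Yv h1
  have hr : Measurable fun a : E p × ℝ => respDens M lam a.1 a.2 := measurable_respDens h1 lam
  have hK : Measurable (Kh h) := by unfold Kh; fun_prop
  have hK0 : ∀ t, 0 ≤ Kh h t := fun t =>
    mul_nonneg (inv_nonneg.2 hh.le) (gaussianPDFReal_nonneg _ _ _)
  rw [smoothObj_eq_toReal h1 lam h hθ, popObj, integral_eq_lintegral_of_nonneg_ae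
    (Eventually.of_forall fun _ => hK0 _)
    (hK.comp (f := fun z => Yv M z - M.m (Wv lam z) θ) (by fun_prop)).aestronglyMeasurable]
  congr 1
  rw [lintegral_resp h1 hC (φ := fun w s => ENNReal.ofReal (Kh h (s - M.m w θ)))
    (hK.comp (f := fun a : E p × ℝ => a.2 - M.m a.1 θ) (by fun_prop)).ennreal_ofReal]
  refine lintegral_congr fun z => ?_
  have hr1 : Measurable fun u => ENNReal.ofReal (respDens M lam (Wv lam z) u) :=
    (hr.comp (f := fun u => (Wv lam z, u)) (by fun_prop)).ennreal_ofReal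
  rw [gaussianReal_of_var_ne_zero _ one_ne_zero,
    lintegral_withDensity_eq_lintegral_mul _ (measurable_gaussianPDF _ _)
      (g := fun u => ENNReal.ofReal (respDens M lam (Wv lam z) (M.m (Wv lam z) θ + h * u)))
      (hr1.comp (by fun_prop : Measurable fun u => M.m (Wv lam z) θ + h * u))]
  rw [← lintegral_add_right_eq_self _ (M.m (Wv lam z) θ)]
  have hscale := Real.map_volume_mul_left hh.ne'
  have hH : Measurable fun s => ENNReal.ofReal (Kh h (s + M.m (Wv lam z) θ - M.m (Wv lam z) θ)) *
      ENNReal.ofReal (respDens M lam (Wv lam z) (s + M.m (Wv lam z) θ)) :=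
    (hK.comp (by fun_prop : Measurable fun s => s + M.m (Wv lam z) θ - M.m (Wv lam z) θ)
      ).ennreal_ofReal.mul (hr1.comp (by fun_prop : Measurable fun s => s + M.m (Wv lam z) θ))
  -- Rescaling Lebesgue measure by `h` produces the factor that cancels the `h⁻¹` in `K_h`, leaving
  -- the standard normal density in `u`.
  have h3 : ∫⁻ s, ENNReal.ofReal (Kh h (s + M.m (Wv lam z) θ - M.m (Wv lam z) θ)) *
      ENNReal.ofReal (respDens M lam (Wv lam z) (s + M.m (Wv lam z) θ)) =
      ENNReal.ofReal h * ∫⁻ s, ENNReal.ofReal (Kh h (s + M.m (Wv lam z) θ - M.m (Wv lam z) θ)) *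
      ENNReal.ofReal (respDens M lam (Wv lam z) (s + M.m (Wv lam z) θ))
        ∂(Measure.map (h * ·) volume) := by
    rw [hscale, lintegral_smul_measure, smul_eq_mul, ← mul_assoc,
      ← ENNReal.ofReal_mul hh.le, abs_of_pos (inv_pos.2 hh), mul_inv_cancel₀ hh.ne',
      ENNReal.ofReal_one, one_mul]
  rw [h3, lintegral_map hH (by fun_prop), ← lintegral_const_mul]
  · refine lintegral_congr fun u => ?_
    simp only [add_sub_cancel_right, Kh, Pi.mul_apply, gaussianPDF]
    rw [mul_div_cancel_left₀ _ hh.ne', ← mul_assoc, ← ENNReal.ofReal_mul hh.le, ← mul_assoc,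
      mul_inv_cancel₀ hh.ne', one_mul, add_comm (h * u)]
  · exact hH.comp (by fun_prop)

end

/-! ### Differentiation under the integral and the quadratic drop. -/

section Curvature

noncomputable instance instNormedAddCommGroupBilin {H : Type*} [NormedAddCommGroup H]
    [NormedSpace ℝ H] : NormedAddCommGroup (H →L[ℝ] H →L[ℝ] ℝ) :=
  ContinuousLinearMap.toNormedAddCommGroup

noncomputable instance instNormedSpaceBilin {H : Type*} [NormedAddCommGroup H]
    [NormedSpace ℝ H] : NormedSpace ℝ (H →L[ℝ] H →L[ℝ] ℝ) :=
  ContinuousLinearMap.toNormedSpace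

variable {α H F : Type*} [MeasurableSpace α] {μ : Measure α} [NormedAddCommGroup H]
  [NormedSpace ℝ H] [NormedAddCommGroup F] [NormedSpace ℝ F]

/-- Each directional derivative is an almost everywhere limit of difference quotients, and in finite
dimension the operator is recovered from its values on a basis. Measurability of the derivative thus
need not be assumed below. -/
lemma aestronglyMeasurable_of_hasFDerivAt [FiniteDimensional ℝ H] {f : α → H → F}
    {f' : α → H →L[ℝ] F} {x₀ : H}
    {r : ℝ} (hr : 0 < r) (hf : ∀ x ∈ Metric.ball x₀ r, AEStronglyMeasurable (f · x) μ)
    (hf' : ∀ᵐ a ∂μ, HasFDerivAt (f a) (f' a) x₀) : AEStronglyMeasurable f' μ := by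
  have key : ∀ v : H, AEStronglyMeasurable (fun a => f' a v) μ := by
    intro v
    -- The shift by `N + 1` keeps every point `x₀ + v / (n + N + 1)` inside the ball.
    obtain ⟨N, hN⟩ := exists_nat_gt (‖v‖ / r)
    have hN0 : (0 : ℝ) < N + 1 := by positivity
    refine aestronglyMeasurable_of_tendsto_ae (u := atTop) (f := fun (n : ℕ) a =>
      ((n : ℝ) + (N + 1)) • (f a (x₀ + ((n : ℝ) + (N + 1))⁻¹ • v) - f a x₀)) (fun n => ?_) ?_
    · have hp : (0 : ℝ) < n + (N + 1) := by positivity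
      refine AEStronglyMeasurable.const_smul (AEStronglyMeasurable.sub (hf _ ?_) (hf _ ?_)) _
      · rw [mem_ball_iff_norm, add_sub_cancel_left, norm_smul, norm_inv, Real.norm_of_nonneg hp.le,
          inv_mul_lt_iff₀ hp]
        rw [div_lt_iff₀ hr] at hN
        nlinarith [(Nat.cast_nonneg n : (0 : ℝ) ≤ n)]
      · exact Metric.mem_ball_self hr
    · filter_upwards [hf'] with a ha
      refine ha.lim v ?_
      have : Tendsto (fun n : ℕ => (n : ℝ) + (N + 1)) atTop atTop :=
        tendsto_atTop_add_const_right _ _ tendsto_natCast_atTop_atTop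
      exact tendsto_norm_atTop_atTop.comp this
  let B := Module.finBasis ℝ H
  have e : f' = fun a => ∑ i, ContinuousLinearMap.smulRightL ℝ H F
      (LinearMap.toContinuousLinearMap (B.coord i)) (f' a (B i)) := by
    ext a v
    conv_lhs => rw [← B.sum_repr v, map_sum]
    simp
  rw [e]
  refine Finset.aestronglyMeasurable_fun_sum _ fun i _ => ?_
  exact (ContinuousLinearMap.continuous _).comp_aestronglyMeasurable (key _)

/-- Integrability of the derivative is part of the conclusion so that the lemma can be applied again
to the derivative. -/
lemma hasFDerivAt_integral_ball [FiniteDimensional ℝ H] {f : α → H → F}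
    {f' : α → H → H →L[ℝ] F} {x₀ : H} {r : ℝ}
    {b : α → ℝ} (hf : ∀ x ∈ Metric.ball x₀ r, Integrable (f · x) μ) (hb : Integrable b μ)
    (hf' : ∀ᵐ a ∂μ, ∀ x ∈ Metric.ball x₀ r, HasFDerivAt (f a) (f' a x) x ∧ ‖f' a x‖ ≤ b a)
    {x : H} (hx : x ∈ Metric.ball x₀ r) :
    Integrable (f' · x) μ ∧ HasFDerivAt (fun y => ∫ a, f a y ∂μ) (∫ a, f' a x ∂μ) x := by
  have hnhds : Metric.ball x₀ r ∈ 𝓝 x := Metric.isOpen_ball.mem_nhds hx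
  have hm : AEStronglyMeasurable (f' · x) μ := by
    obtain ⟨δ, hδ, hsub⟩ := Metric.mem_nhds_iff.1 hnhds
    exact aestronglyMeasurable_of_hasFDerivAt hδ
      (fun y hy => (hf y (hsub hy)).aestronglyMeasurable) (hf'.mono fun a ha => (ha x hx).1)
  refine ⟨hb.mono' hm (hf'.mono fun a ha => (ha x hx).2), ?_⟩
  exact hasFDerivAt_integral_of_dominated_of_fderiv_le (F := fun y a => f a y)
    (F' := fun y a => f' a y) hnhds
    (eventually_of_mem hnhds fun y hy => (hf y hy).aestronglyMeasurable) (hf x hx) hm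
    (hf'.mono fun a ha y hy => (ha y hy).2) hb (hf'.mono fun a ha y hy => (ha y hy).1)

/-- A family of objectives `a ↦ d a (m a θ + h * ξ a)`, `h ∈ ℝ`, that can be differentiated twice
in `θ` under the integral sign on `ball θl r`. -/
structure SmoothFamily (μ : Measure α) (m : α → H → ℝ) (ξ : α → ℝ) (d : α → ℝ → ℝ) (G : α → ℝ)
    (θl : H) (r C : ℝ) : Prop where
  pos : 0 < r
  C_nonneg : 0 ≤ C
  integrable_G : Integrable G μ
  integrable : ∀ h, ∀ θ ∈ Metric.ball θl r, Integrable (fun a => d a (m a θ + h * ξ a)) μ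
  contDiffAt : ∀ a, ∀ θ ∈ Metric.ball θl r, ContDiffAt ℝ 3 (m a) θ
  bound_m : ∀ a, ∀ θ ∈ Metric.ball θl r,
    ‖fderiv ℝ (m a) θ‖ ^ 2 ≤ G a ∧ ‖fderiv ℝ (fderiv ℝ (m a)) θ‖ ≤ G a
  regular : ∀ᵐ a ∂μ, ContDiff ℝ 3 (d a) ∧
    ∀ s, |deriv (d a) s| ≤ C ∧ |deriv (deriv (d a)) s| ≤ C

/-- The derivative in `θ` of `d (m θ + h)`. -/
noncomputable def score (m : H → ℝ) (d : ℝ → ℝ) (h : ℝ) (θ : H) : H →L[ℝ] ℝ :=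
  deriv d (m θ + h) • fderiv ℝ m θ

/-- The second derivative in `θ` of `d (m θ + h)`. -/
noncomputable def hess (m : H → ℝ) (d : ℝ → ℝ) (h : ℝ) (θ : H) : H →L[ℝ] H →L[ℝ] ℝ :=
  deriv d (m θ + h) • fderiv ℝ (fderiv ℝ m) θ +
    (deriv (deriv d) (m θ + h) • fderiv ℝ m θ).smulRight (fderiv ℝ m θ)

lemma hasDerivAt_of_contDiff {d : ℝ → ℝ} (hd : ContDiff ℝ 3 d) (s : ℝ) :
    HasDerivAt d (deriv d s) s ∧ HasDerivAt (deriv d) (deriv (deriv d) s) s ∧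
      Continuous (deriv d) ∧ Continuous (deriv (deriv d)) := by
  have h1 : ContDiff ℝ 2 (deriv d) := by
    simpa using hd.iterate_deriv' 2 1
  have h2 : ContDiff ℝ 1 (deriv (deriv d)) := by
    simpa using hd.iterate_deriv' 1 2
  exact ⟨(hd.differentiable (by norm_num) s).hasDerivAt,
    (h1.differentiable (by norm_num) s).hasDerivAt, h1.continuous, h2.continuous⟩

lemma hasFDerivAt_score {m : H → ℝ} {d : ℝ → ℝ} (hd : ContDiff ℝ 3 d) (h : ℝ) {θ : H}
    (hm : ContDiffAt ℝ 3 m θ) :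
    HasFDerivAt (fun θ => d (m θ + h)) (score m d h θ) θ ∧
      HasFDerivAt (score m d h) (hess m d h θ) θ := by
  have hm1 := (hm.differentiableAt (by norm_num)).hasFDerivAt.add_const h
  have hm2 := ((hm.fderiv_right (m := 2) (by norm_num)).differentiableAt (by norm_num)).hasFDerivAt
  have hd := hasDerivAt_of_contDiff hd (m θ + h)
  have e1 := HasDerivAt.comp_hasFDerivAt (h₂ := d) θ hd.1 hm1
  have e2 := HasDerivAt.comp_hasFDerivAt (h₂ := deriv d) θ hd.2.1 hm1
  exact ⟨e1, e2.smul hm2⟩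

lemma norm_score_le {m : H → ℝ} {d : ℝ → ℝ} {h : ℝ} {θ : H} {C G : ℝ}
    (hd : ∀ s, |deriv d s| ≤ C) (hm : ‖fderiv ℝ m θ‖ ^ 2 ≤ G) (hC : 0 ≤ C) :
    ‖score m d h θ‖ ≤ C * (1 + G) := by
  rw [score, norm_smul, Real.norm_eq_abs]
  refine mul_le_mul (hd _) ?_ (norm_nonneg _) hC
  -- Only the square of the gradient is dominated; `x ≤ 1 + x²` gives a bound for its first power.
  nlinarith [sq_nonneg (‖fderiv ℝ m θ‖ - 1), norm_nonneg (fderiv ℝ m θ)]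

lemma norm_hess_le {m : H → ℝ} {d : ℝ → ℝ} {h : ℝ} {θ : H} {C G : ℝ}
    (hd : ∀ s, |deriv d s| ≤ C ∧ |deriv (deriv d) s| ≤ C)
    (hm : ‖fderiv ℝ m θ‖ ^ 2 ≤ G ∧ ‖fderiv ℝ (fderiv ℝ m) θ‖ ≤ G) (hC : 0 ≤ C) :
    ‖hess m d h θ‖ ≤ 2 * C * G := by
  rw [hess]
  refine (norm_add_le _ _).trans ?_
  rw [ContinuousLinearMap.norm_smulRight_apply, norm_smul, norm_smul, Real.norm_eq_abs,
    Real.norm_eq_abs, mul_assoc, ← pow_two]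
  have e1 := mul_le_mul (hd (m θ + h)).1 hm.2 (norm_nonneg _) hC
  have e2 := mul_le_mul (hd (m θ + h)).2 hm.1 (sq_nonneg _) hC
  linarith

lemma continuousAt_hess {m : H → ℝ} {d : ℝ → ℝ} (hd : ContDiff ℝ 3 d) (c : ℝ) {θ : H}
    (hm : ContDiffAt ℝ 3 m θ) :
    ContinuousAt (fun a : ℝ × H => hess m d (a.1 * c) a.2) (0, θ) := by
  have hd := hasDerivAt_of_contDiff hd 0
  have hs : ContinuousAt (fun a : ℝ × H => a.2) (0, θ) := continuousAt_snd
  have hm1 := hm.fderiv_right (m := 2) (by norm_num)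
  have hm2 := hm1.fderiv_right (m := 1) (by norm_num)
  have c0 : ContinuousAt (fun a : ℝ × H => m a.2 + a.1 * c) (0, θ) :=
    (ContinuousAt.comp (f := fun a : ℝ × H => a.2) (x := (0, θ)) hm.continuousAt hs).add
      (continuousAt_fst.mul continuousAt_const)
  have c1 : ContinuousAt (fun a : ℝ × H => fderiv ℝ m a.2) (0, θ) :=
    ContinuousAt.comp (f := fun a : ℝ × H => a.2) (x := (0, θ)) hm1.continuousAt hs
  have c2 : ContinuousAt (fun a : ℝ × H => fderiv ℝ (fderiv ℝ m) a.2) (0, θ) :=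
    ContinuousAt.comp (f := fun a : ℝ × H => a.2) (x := (0, θ)) hm2.continuousAt hs
  have hd1 := ContinuousAt.comp (x := ((0 : ℝ), θ)) hd.2.2.1.continuousAt c0
  have hd2 := ContinuousAt.comp (x := ((0 : ℝ), θ)) hd.2.2.2.continuousAt c0
  have hR : Continuous fun b : (H →L[ℝ] ℝ) × (H →L[ℝ] ℝ) => b.1.smulRight b.2 :=
    (ContinuousLinearMap.smulRightL ℝ H (H →L[ℝ] ℝ)).continuous₂
  exact (hd1.smul c2).add (hR.continuousAt.comp (x := ((0 : ℝ), θ)) ((hd2.smul c1).prodMk c1))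

namespace SmoothFamily

variable {m : α → H → ℝ} {ξ : α → ℝ} {d : α → ℝ → ℝ} {G : α → ℝ} {θl : H} {r C : ℝ}

lemma hasFDerivAt [FiniteDimensional ℝ H] [IsFiniteMeasure μ]
    (S : SmoothFamily μ m ξ d G θl r C) (h : ℝ) {θ : H}
    (hθ : θ ∈ Metric.ball θl r) :
    Integrable (fun a => score (m a) (d a) (h * ξ a) θ) μ ∧
      HasFDerivAt (fun θ => ∫ a, d a (m a θ + h * ξ a) ∂μ)
        (∫ a, score (m a) (d a) (h * ξ a) θ ∂μ) θ := by
  refine hasFDerivAt_integral_ball (f := fun a θ => d a (m a θ + h * ξ a))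
    (f' := fun a θ => score (m a) (d a) (h * ξ a) θ) (x₀ := θl) (r := r)
    (b := fun a => C * (1 + G a)) (S.integrable h)
    (((integrable_const 1).add S.integrable_G).const_mul C) ?_ hθ
  filter_upwards [S.regular] with a ha x hx
  exact ⟨(hasFDerivAt_score ha.1 _ (S.contDiffAt a x hx)).1,
    norm_score_le (fun s => (ha.2 s).1) (S.bound_m a x hx).1 S.C_nonneg⟩

lemma hasFDerivAt_score [FiniteDimensional ℝ H] [IsFiniteMeasure μ]
    (S : SmoothFamily μ m ξ d G θl r C) (h : ℝ) {θ : H}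
    (hθ : θ ∈ Metric.ball θl r) :
    Integrable (fun a => hess (m a) (d a) (h * ξ a) θ) μ ∧
      HasFDerivAt (fun θ => ∫ a, score (m a) (d a) (h * ξ a) θ ∂μ)
        (∫ a, hess (m a) (d a) (h * ξ a) θ ∂μ) θ := by
  refine hasFDerivAt_integral_ball (f := fun a θ => score (m a) (d a) (h * ξ a) θ)
    (f' := fun a θ => hess (m a) (d a) (h * ξ a) θ) (x₀ := θl) (r := r)
    (b := fun a => 2 * C * G a) (fun x hx => (S.hasFDerivAt h hx).1)
    (S.integrable_G.const_mul _) ?_ hθ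
  filter_upwards [S.regular] with a ha x hx
  exact ⟨(SimexModal.hasFDerivAt_score ha.1 _ (S.contDiffAt a x hx)).2,
    norm_hess_le ha.2 (S.bound_m a x hx) S.C_nonneg⟩

/-- Dominated convergence with the bandwidth treated as one more parameter: continuity holds jointly
in `(h, θ)`, so curvature at `(0, θl)` persists for all small `h` at once. -/
lemma tendsto_hess [FiniteDimensional ℝ H] [IsFiniteMeasure μ]
    (S : SmoothFamily μ m ξ d G θl r C) :
    Tendsto (fun b : ℝ × H => ∫ a, hess (m a) (d a) (b.1 * ξ a) b.2 ∂μ) (𝓝 (0, θl))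
      (𝓝 (∫ a, hess (m a) (d a) (0 * ξ a) θl ∂μ)) := by
  have hl : θl ∈ Metric.ball θl r := Metric.mem_ball_self S.pos
  have hev : ∀ᶠ b : ℝ × H in 𝓝 (0, θl), b.2 ∈ Metric.ball θl r :=
    continuous_snd.continuousAt.eventually (Metric.isOpen_ball.mem_nhds hl)
  refine tendsto_integral_filter_of_dominated_convergence (fun a => 2 * C * G a)
    (hev.mono fun b hb => (S.hasFDerivAt_score b.1 hb).1.aestronglyMeasurable)
    (hev.mono fun b hb => ?_) (S.integrable_G.const_mul _) ?_
  · filter_upwards [S.regular] with a ha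
    exact norm_hess_le ha.2 (S.bound_m a b.2 hb) S.C_nonneg
  · filter_upwards [S.regular] with a ha
    exact continuousAt_hess ha.1 (ξ a) (S.contDiffAt a θl hl)

end SmoothFamily

/-- Compactness of the unit sphere and homogeneity. An empty sphere means a trivial space, where any
constant works. -/
lemma exists_neg_definite_bound [FiniteDimensional ℝ H]
    (A : H →L[ℝ] H →L[ℝ] ℝ) (hA : ∀ v, v ≠ 0 → A v v < 0) :
    ∃ c > 0, ∀ v, A v v ≤ -c * ‖v‖ ^ 2 := by
  have hcomp : IsCompact (Metric.sphere (0 : H) 1) := isCompact_sphere 0 1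
  have hcont : Continuous fun v => A v v := by fun_prop
  rcases (Metric.sphere (0 : H) 1).eq_empty_or_nonempty with he | hne
  · refine ⟨1, one_pos, fun v => ?_⟩
    rcases eq_or_ne v 0 with rfl | hv
    · simp
    · exfalso
      have : (‖v‖⁻¹ • v) ∈ Metric.sphere (0 : H) 1 := by
        simp [norm_smul, norm_ne_zero_iff.2 hv]
      rw [he] at this; exact this
  · obtain ⟨u, hu, hmax⟩ := hcomp.exists_isMaxOn hne hcont.continuousOn
    have hu0 : u ≠ 0 := by
      rintro rfl; simp at hu
    refine ⟨-A u u, by linarith [hA u hu0], fun v => ?_⟩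
    rcases eq_or_ne v 0 with rfl | hv
    · simp
    · have hvn : ‖v‖ ≠ 0 := norm_ne_zero_iff.2 hv
      have hs : (‖v‖⁻¹ • v) ∈ Metric.sphere (0 : H) 1 := by
        simp [norm_smul, hvn]
      have := hmax hs
      simp only [Set.mem_ofPred_eq, map_smul, smul_apply, smul_eq_mul] at this
      rw [neg_neg]
      have h2 : A v v = ‖v‖ ^ 2 * (‖v‖⁻¹ * (‖v‖⁻¹ * A v v)) := by field_simp
      rw [h2, mul_comm (A u u)]
      exact mul_le_mul_of_nonneg_left this (sq_nonneg _)

/-- Second-order upper bound at a critical point. -/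
lemma le_sub_of_hess_le {f : H → ℝ} {f' : H → H →L[ℝ] ℝ} {f'' : H → H →L[ℝ] H →L[ℝ] ℝ} {s : Set H}
    (hs : Convex ℝ s) (h1 : ∀ x ∈ s, HasFDerivAt f (f' x) x)
    (h2 : ∀ x ∈ s, HasFDerivAt f' (f'' x) x) {c : ℝ}
    (hc : ∀ x ∈ s, ∀ v, f'' x v v ≤ -(2 * c) * ‖v‖ ^ 2) {x₀ x : H} (hx₀ : x₀ ∈ s) (hx : x ∈ s)
    (h0 : f' x₀ = 0) : f x ≤ f x₀ - c * ‖x - x₀‖ ^ 2 := by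
  set v := x - x₀ with hv
  have hline : ∀ t ∈ Set.Icc (0 : ℝ) 1, x₀ + t • v ∈ s := fun t ht =>
    hs.add_smul_sub_mem hx₀ hx ht
  have hl : ∀ t : ℝ, HasDerivAt (fun t : ℝ => x₀ + t • v) v t := fun t => by
    simpa using ((hasDerivAt_id t).smul_const v).const_add x₀
  have d1 : ∀ t ∈ Set.Icc (0 : ℝ) 1, HasDerivAt (fun t => f (x₀ + t • v)) (f' (x₀ + t • v) v) t :=
    fun t ht => (h1 _ (hline t ht)).comp_hasDerivAt t (hl t)
  have d2 : ∀ t ∈ Set.Icc (0 : ℝ) 1,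
      HasDerivAt (fun t => f' (x₀ + t • v) v) (f'' (x₀ + t • v) v v) t := fun t ht => by
    have := (h2 _ (hline t ht)).comp_hasDerivAt t (hl t)
    exact this.clm_apply (hasDerivAt_const t v) |>.congr_deriv (by simp)
  -- The Hessian bound is integrated twice along the segment, each time as monotonicity: the
  -- compensating polynomial in `t` makes the derivative nonpositive.
  have g1 : ∀ t ∈ Set.Icc (0 : ℝ) 1, f' (x₀ + t • v) v ≤ -(2 * c * ‖v‖ ^ 2) * t := by
    have hanti : AntitoneOn (fun t => f' (x₀ + t • v) v + 2 * c * ‖v‖ ^ 2 * t)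
        (Set.Icc 0 1) := by
      refine antitoneOn_of_hasDerivWithinAt_nonpos (convex_Icc 0 1)
        (f' := fun t => f'' (x₀ + t • v) v v + 2 * c * ‖v‖ ^ 2) ?_ ?_ ?_
      · exact fun t ht => ((d2 t ht).continuousAt.add (by fun_prop)).continuousWithinAt
      · intro t ht
        have ht' := interior_subset ht
        have e := (d2 t ht').add ((hasDerivAt_id t).const_mul (2 * c * ‖v‖ ^ 2))
        exact (e.congr_deriv (by simp)).hasDerivWithinAt
      · intro t ht
        have := hc _ (hline t (interior_subset ht)) v
        linarith
    intro t ht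
    have := hanti (Set.left_mem_Icc.2 zero_le_one) ht ht.1
    simp [h0] at this
    linarith
  have hanti : AntitoneOn (fun t => f (x₀ + t • v) + c * ‖v‖ ^ 2 * t ^ 2) (Set.Icc 0 1) := by
    refine antitoneOn_of_hasDerivWithinAt_nonpos (convex_Icc 0 1)
      (f' := fun t => f' (x₀ + t • v) v + c * ‖v‖ ^ 2 * (2 * t)) ?_ ?_ ?_
    · exact fun t ht => ((d1 t ht).continuousAt.add (by fun_prop)).continuousWithinAt
    · intro t ht
      have e := (d1 t (interior_subset ht)).add ((hasDerivAt_pow 2 t).const_mul (c * ‖v‖ ^ 2))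
      exact (e.congr_deriv (by simp)).hasDerivWithinAt
    · intro t ht
      have := g1 t (interior_subset ht)
      linarith
  have := hanti (Set.left_mem_Icc.2 zero_le_one) (Set.right_mem_Icc.2 zero_le_one) zero_le_one
  simp [hv] at this
  simp only [hv]
  linarith

/-- The Hessian stays uniformly negative definite on a convex neighbourhood of `θl` for all small
`|h|`, so the second-order bound may be centred at whatever critical point `θ'` that bandwidth has.
-/
lemma SmoothFamily.exists_quadratic_drop [FiniteDimensional ℝ H] [IsFiniteMeasure μ]
    {m : α → H → ℝ} {ξ : α → ℝ}
    {d : α → ℝ → ℝ} {G : α → ℝ} {θl : H} {r C : ℝ} (S : SmoothFamily μ m ξ d G θl r C)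
    (hneg : ∀ v, v ≠ 0 →
      fderiv ℝ (fderiv ℝ (fun θ => ∫ a, d a (m a θ + 0 * ξ a) ∂μ)) θl v v < 0) :
    ∃ c > 0, ∃ δ > 0, δ ≤ r ∧ ∀ h, |h| < δ → ∀ θ' ∈ Metric.ball θl δ,
      HasFDerivAt (fun θ => ∫ a, d a (m a θ + h * ξ a) ∂μ) (0 : H →L[ℝ] ℝ) θ' →
      ∀ θ ∈ Metric.ball θl δ, ∫ a, d a (m a θ + h * ξ a) ∂μ ≤
        ∫ a, d a (m a θ' + h * ξ a) ∂μ - c * ‖θ - θ'‖ ^ 2 := by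
  have hl : θl ∈ Metric.ball θl r := Metric.mem_ball_self S.pos
  set A := ∫ a, hess (m a) (d a) (0 * ξ a) θl ∂μ with hA
  have hAeq : fderiv ℝ (fderiv ℝ (fun θ => ∫ a, d a (m a θ + 0 * ξ a) ∂μ)) θl = A := by
    have h1 : fderiv ℝ (fun θ => ∫ a, d a (m a θ + 0 * ξ a) ∂μ) =ᶠ[𝓝 θl]
        fun θ => ∫ a, score (m a) (d a) (0 * ξ a) θ ∂μ := by
      filter_upwards [Metric.isOpen_ball.mem_nhds hl] with θ hθ
      exact (S.hasFDerivAt 0 hθ).2.fderiv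
    rw [h1.fderiv_eq]
    exact (S.hasFDerivAt_score 0 hl).2.fderiv
  rw [hAeq] at hneg
  obtain ⟨c, hc, hcA⟩ := exists_neg_definite_bound A hneg
  have hev := S.tendsto_hess.eventually (Metric.ball_mem_nhds A (half_pos hc))
  obtain ⟨δ, hδ, hsub⟩ := Metric.eventually_nhds_iff_ball.1 hev
  -- One factor `1/2` is lost by allowing the Hessian to move by `c / 2` in norm, the other is the
  -- `1/2` of the Taylor expansion.
  refine ⟨c / 4, by positivity, min δ r, lt_min hδ S.pos, min_le_right _ _, ?_⟩
  intro h hh θ' hθ' hcrit θ hθ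
  have hr : ∀ x ∈ Metric.ball θl (min δ r), x ∈ Metric.ball θl r := fun x hx =>
    Metric.ball_subset_ball (min_le_right _ _) hx
  refine le_sub_of_hess_le (convex_ball θl (min δ r))
    (fun x hx => (S.hasFDerivAt h (hr x hx)).2)
    (fun x hx => (S.hasFDerivAt_score h (hr x hx)).2) (c := c / 4) ?_ hθ' hθ
    ((S.hasFDerivAt h (hr _ hθ')).2.unique hcrit)
  intro x hx v
  have hmem : (h, x) ∈ Metric.ball ((0 : ℝ), θl) δ := by
    rw [Metric.mem_ball, Prod.dist_eq, max_lt_iff]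
    refine ⟨?_, ?_⟩
    · simpa using hh.trans_le (min_le_left _ _)
    · exact Metric.mem_ball.1 (Metric.ball_subset_ball (min_le_left _ _) hx)
  have hnear := hsub _ hmem
  rw [dist_eq_norm] at hnear
  simp only at hnear
  set B := ∫ a, hess (m a) (d a) (h * ξ a) x ∂μ
  have h1 : (B - A) v v ≤ c / 2 * ‖v‖ ^ 2 := by
    refine (le_abs_self _).trans ?_
    rw [← Real.norm_eq_abs]
    refine ((B - A).le_opNorm₂ v v).trans ?_
    rw [mul_assoc, ← pow_two]
    exact mul_le_mul_of_nonneg_right hnear.le (sq_nonneg _)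
  have h2 := hcA v
  have h3 : B v v = (B - A) v v + A v v := by simp
  rw [h3]
  linarith

end Curvature

/-! ### The population objective near `θl`. -/

section

variable {p q : ℕ}

/-- On `ball θl r`, inside `Θ`, the derivatives of the regression function are dominated by `G`. -/
structure GoodBall (M : Model p q) (lam : ℝ) (θl : E q) (r : ℝ) (G : E p → ℝ) : Prop where
  pos : 0 < r
  subset : Metric.ball θl r ⊆ interior M.Θ
  integrable : Integrable (fun z => G (Wv lam z)) M.popLaw
  bound : ∀ w, ∀ θ ∈ Metric.ball θl r,
    ‖fderiv ℝ (M.m w) θ‖ ^ 2 ≤ G w ∧ ‖fderiv ℝ (fderiv ℝ (M.m w)) θ‖ ≤ G w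

lemma exists_goodBall {M : Model p q} {lam : ℝ} {θl : E q} (hθl : θl ∈ interior M.Θ)
    (hdom : LocallyDominated M lam θl) : ∃ r G, GoodBall M lam θl r G := by
  obtain ⟨r, hr, G, hG, hb⟩ := hdom
  obtain ⟨δ, hδ, hsub⟩ := Metric.mem_nhds_iff.1 (isOpen_interior.mem_nhds hθl)
  refine ⟨min r δ, G, lt_min hr hδ, (Metric.ball_subset_ball (min_le_right _ _)).trans hsub, hG,
    fun w θ hθ => hb w θ (Metric.ball_subset_ball (min_le_left _ _) hθ)⟩

variable {M : Model p q} {lam : ℝ} {θl : E q} {r : ℝ} {G : E p → ℝ}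

lemma GoodBall.mem (hB : GoodBall M lam θl r G) {θ : E q} (hθ : θ ∈ Metric.ball θl r) :
    θ ∈ M.Θ := interior_subset (hB.subset hθ)

lemma GoodBall.nonneg (hB : GoodBall M lam θl r G) (w : E p) : 0 ≤ G w :=
  (sq_nonneg _).trans (hB.bound w θl (Metric.mem_ball_self hB.pos)).1

lemma GoodBall.contDiffAt (hB : GoodBall M lam θl r G) (h1 : C1 M) (w : E p) {θ : E q}
    (hθ : θ ∈ Metric.ball θl r) : ContDiffAt ℝ 3 (M.m w) θ :=
  (h1.1 w).contDiffAt (isOpen_interior.mem_nhds (hB.subset hθ))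

lemma GoodBall.abs_sub_le (hB : GoodBall M lam θl r G) (h1 : C1 M) (w : E p) {θ θ' : E q}
    (hθ : θ ∈ Metric.ball θl r) (hθ' : θ' ∈ Metric.ball θl r) :
    |M.m w θ - M.m w θ'| ≤ Real.sqrt (G w) * ‖θ - θ'‖ := by
  refine (convex_ball θl r).norm_image_sub_le_of_norm_fderiv_le (𝕜 := ℝ)
    (fun x hx => (hB.contDiffAt h1 w hx).differentiableAt (by norm_num)) (fun x hx => ?_) hθ' hθ
  exact Real.le_sqrt_of_sq_le (hB.bound w x hx).1

lemma RegularDens.ae_prod {C : ℝ} (hC : RegularDens M lam C) :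
    ∀ᵐ z ∂(M.popLaw.prod (gaussianReal 0 1)), ContDiff ℝ 3 (respDens M lam (Wv lam z.1)) ∧
      (∀ s, |deriv (respDens M lam (Wv lam z.1)) s| ≤ C ∧
        |deriv (deriv (respDens M lam (Wv lam z.1))) s| ≤ C) ∧
      ∀ s, respDens M lam (Wv lam z.1) s ≤ C := by
  have : ∀ᵐ z ∂M.popLaw, ContDiff ℝ 3 (respDens M lam (Wv lam z)) ∧
      (∀ s, |deriv (respDens M lam (Wv lam z)) s| ≤ C ∧
        |deriv (deriv (respDens M lam (Wv lam z))) s| ≤ C) ∧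
      ∀ s, respDens M lam (Wv lam z) s ≤ C := by
    filter_upwards [hC] with z hz
    refine ⟨hz.2.1, fun s => ⟨?_, ?_⟩, fun s => ?_⟩
    · have := hz.2.2 1 (by norm_num) s
      rwa [iteratedDeriv_one] at this
    · have := hz.2.2 2 (by norm_num) s
      rwa [iteratedDeriv_succ, iteratedDeriv_one] at this
    · have := hz.2.2 0 (by norm_num) s
      rw [iteratedDeriv_zero] at this
      exact (le_abs_self _).trans this
  exact Measure.quasiMeasurePreserving_fst.ae this

lemma integrable_smoothObj_integrand (h1 : C1 M) {C : ℝ} (hC : RegularDens M lam C) (h : ℝ)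
    {θ : E q} (hθ : θ ∈ M.Θ) :
    Integrable (fun z => respDens M lam (Wv lam z.1) (M.m (Wv lam z.1) θ + h * z.2))
      (M.popLaw.prod (gaussianReal 0 1)) := by
  refine Integrable.of_bound (measurable_respDens_comp h1 lam h hθ).aestronglyMeasurable C ?_
  filter_upwards [hC.ae_prod] with z hz
  rw [Real.norm_of_nonneg (respDens_nonneg _ _ _ _)]
  exact hz.2.2 _

lemma GoodBall.smoothFamily (hB : GoodBall M lam θl r G) (h1 : C1 M) {C : ℝ} (hC0 : 0 ≤ C)
    (hC : RegularDens M lam C) :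
    SmoothFamily (M.popLaw.prod (gaussianReal 0 1)) (fun z => M.m (Wv lam z.1)) (fun z => z.2)
      (fun z => respDens M lam (Wv lam z.1)) (fun z => G (Wv lam z.1)) θl r C where
  pos := hB.pos
  C_nonneg := hC0
  integrable_G := hB.integrable.comp_fst _
  integrable h _ hθ := integrable_smoothObj_integrand h1 hC h (hB.mem hθ)
  contDiffAt _ _ hθ := hB.contDiffAt h1 _ hθ
  bound_m _ _ hθ := hB.bound _ _ hθ
  regular := hC.ae_prod.mono fun _ hz => ⟨hz.1, hz.2.1⟩

/-- The smoothing bias is `O(h)`, uniformly over `Θ`. -/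
lemma abs_smoothObj_sub_le (h1 : C1 M) {C : ℝ} (hC : RegularDens M lam C) {h : ℝ}
    (hh : 0 ≤ h) {θ : E q} (hθ : θ ∈ M.Θ) :
    |smoothObj M lam h θ - smoothObj M lam 0 θ| ≤ C * h * ∫ u, |u| ∂gaussianReal 0 1 := by
  have hu : Integrable (fun u : ℝ => |u|) (gaussianReal 0 1) :=
    (memLp_id_gaussianReal (μ := 0) (v := 1) 1).integrable le_rfl |>.norm
  have hu' : Integrable (fun z : ((E p × ℝ) × E p × E p) × ℝ => C * h * |z.2|)
      (M.popLaw.prod (gaussianReal 0 1)) := (hu.comp_snd _).const_mul _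
  rw [smoothObj, smoothObj, ← integral_sub (integrable_smoothObj_integrand h1 hC h hθ)
    (integrable_smoothObj_integrand h1 hC 0 hθ)]
  have e : C * h * ∫ u, |u| ∂gaussianReal 0 1 =
      ∫ z, C * h * |z.2| ∂(M.popLaw.prod (gaussianReal 0 1)) := by
    rw [integral_const_mul, integral_fun_snd]
    simp
  rw [e, ← Real.norm_eq_abs]
  refine norm_integral_le_of_norm_le hu' ?_
  filter_upwards [hC.ae_prod] with z hz
  have := convex_univ.norm_image_sub_le_of_norm_deriv_le (𝕜 := ℝ)
    (f := respDens M lam (Wv lam z.1)) (C := C)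
    (fun x _ => hz.1.differentiable (by norm_num) x) (fun x _ => (hz.2.1 x).1)
    (Set.mem_univ (M.m (Wv lam z.1) θ + 0 * z.2)) (Set.mem_univ (M.m (Wv lam z.1) θ + h * z.2))
  refine this.trans (le_of_eq ?_)
  simp [abs_of_nonneg hh, mul_assoc]

/-- Since the bias is `O(h)`, the limit that defines `θ(lam)` is the smoothed objective at bandwidth
zero; separation can then be compared with the objective at `h > 0`. -/
lemma limit_eq_smoothObj (h1 : C1 M) {C : ℝ} (hC : RegularDens M lam C) {Q : E q → ℝ}
    (hQ : ∀ θ ∈ M.Θ, Tendsto (fun h => popObj M lam h θ) (𝓝[>] 0) (𝓝 (Q θ))) {θ : E q}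
    (hθ : θ ∈ M.Θ) : Q θ = smoothObj M lam 0 θ := by
  refine tendsto_nhds_unique (hQ θ hθ) ?_
  rw [tendsto_iff_dist_tendsto_zero]
  have hlim : Tendsto (fun h : ℝ => C * h * ∫ u, |u| ∂gaussianReal 0 1) (𝓝[>] 0) (𝓝 0) := by
    have : Tendsto (fun h : ℝ => C * h * ∫ u, |u| ∂gaussianReal 0 1) (𝓝 0)
        (𝓝 (C * 0 * ∫ u, |u| ∂gaussianReal 0 1)) :=
      Continuous.tendsto (by fun_prop) 0
    simp only [mul_zero, zero_mul] at this
    exact this.mono_left nhdsWithin_le_nhds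
  refine squeeze_zero' (Eventually.of_forall fun _ => dist_nonneg) ?_ hlim
  filter_upwards [self_mem_nhdsWithin] with h hh
  rw [popObj_eq_smoothObj h1 hC hh hθ, Real.dist_eq]
  exact abs_smoothObj_sub_le h1 hC (le_of_lt hh) hθ

/-- The smoothed parameter `θ(lam, h)` converges to `θ(lam)`. -/
lemma tendsto_smoothed_param (h1 : C1 M) {C : ℝ} (hC : RegularDens M lam C)
    (hθl : IsLimitArgmax M lam θl) {h : ℕ → ℝ} {θh : ℝ → E q} (h4 : C4 M lam h θh) (h5 : C5 h) :
    Tendsto (fun n => θh (h n)) atTop (𝓝 θl) := by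
  obtain ⟨hint, Q, hQ, hsep⟩ := hθl
  have hl : θl ∈ M.Θ := interior_subset hint
  rw [Metric.tendsto_nhds]
  intro r hr
  obtain ⟨δ, hδ, hδQ⟩ := hsep r hr
  have hlim : Tendsto (fun n => C * h n * ∫ u, |u| ∂gaussianReal 0 1) atTop (𝓝 0) := by
    have := (h5.2.1.const_mul C).mul_const (∫ u, |u| ∂gaussianReal 0 1)
    simpa using this
  -- A bias below `δ / 2` at each of the two points cannot make up for the separation gap `δ`.
  filter_upwards [h4, hlim.eventually (gt_mem_nhds (show 0 < δ / 2 by positivity))] with n hn hb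
  by_contra hcon
  rw [dist_eq_norm, not_lt] at hcon
  have e1 := hδQ _ hn.1 hcon
  rw [limit_eq_smoothObj h1 hC hQ hn.1, limit_eq_smoothObj h1 hC hQ hl] at e1
  have e2 := abs_le.1 (abs_smoothObj_sub_le h1 hC (h5.1 n).le hn.1)
  have e3 := abs_le.1 (abs_smoothObj_sub_le h1 hC (h5.1 n).le hl)
  have hne : θl ≠ θh (h n) := by
    rintro heq
    rw [← heq] at hcon
    simp at hcon
    linarith
  have e4 := hn.2.1 θl hl hne
  rw [popObj_eq_smoothObj h1 hC (h5.1 n) hn.1, popObj_eq_smoothObj h1 hC (h5.1 n) hl] at e4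
  linarith [e2.1, e2.2, e3.1, e3.2]

/-- The population objective drops quadratically around the smoothed parameter. -/
lemma exists_popObj_drop (h1 : C1 M) (h3 : C3 M lam θl) (hB : GoodBall M lam θl r G) {C : ℝ}
    (hC0 : 0 ≤ C) (hC : RegularDens M lam C) (hθl : IsLimitArgmax M lam θl) {h : ℕ → ℝ}
    {θh : ℝ → E q} (h4 : C4 M lam h θh) (h5 : C5 h) :
    ∃ c > 0, ∃ δ > 0, δ ≤ r ∧ ∀ᶠ n in atTop, ∀ θ ∈ Metric.ball θl δ,
      popObj M lam (h n) θ ≤ popObj M lam (h n) (θh (h n)) - c * ‖θ - θh (h n)‖ ^ 2 := by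
  have S := hB.smoothFamily h1 hC0 hC
  have hl : θl ∈ Metric.ball θl r := Metric.mem_ball_self hB.pos
  have hmean : meanDens M lam =ᶠ[𝓝 θl] smoothObj M lam 0 := by
    filter_upwards [Metric.isOpen_ball.mem_nhds hl] with θ hθ
    exact meanDens_eq_smoothObj h1 hC (hB.mem hθ)
  have hneg : ∀ v : E q, v ≠ 0 →
      fderiv ℝ (fderiv ℝ (smoothObj M lam 0)) θl v v < 0 := by
    intro v hv
    rw [← hmean.fderiv.fderiv_eq]
    exact h3.2 v hv
  obtain ⟨c, hc, δ, hδ, hδr, hdrop⟩ := S.exists_quadratic_drop hneg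
  refine ⟨c, hc, δ, hδ, hδr, ?_⟩
  have hθh := tendsto_smoothed_param h1 hC hθl h4 h5
  filter_upwards [h4, hθh.eventually (Metric.isOpen_ball.mem_nhds (Metric.mem_ball_self hδ)),
    h5.2.1.eventually (Metric.ball_mem_nhds 0 hδ)] with n hn hnb hnh θ hθ
  have hsub := Metric.ball_subset_ball hδr (x := θl)
  have hgrad : HasFDerivAt (smoothObj M lam (h n)) (0 : E q →L[ℝ] ℝ) (θh (h n)) := by
    have := hn.2.2.2.2.hasFDerivAt
    rw [map_zero] at this
    refine this.congr_of_eventuallyEq ?_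
    filter_upwards [Metric.isOpen_ball.mem_nhds (hsub hnb)] with θ hθ
    exact (popObj_eq_smoothObj h1 hC (h5.1 n) (hB.mem hθ)).symm
  have := hdrop (h n) (by simpa using hnh) _ hnb hgrad θ hθ
  rw [popObj_eq_smoothObj h1 hC (h5.1 n) (hB.mem (hsub hθ)),
    popObj_eq_smoothObj h1 hC (h5.1 n) hn.1]
  exact this

end

/-! ### Exponential and Markov inequalities for i.i.d. averages. -/

section Bernstein

variable {Ω Z : Type*} [MeasurableSpace Ω] [MeasurableSpace Z] {P : Measure Ω}
  [IsProbabilityMeasure P] {μ : Measure Z}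

/-- `ζ` is an i.i.d. sequence with law `μ`. -/
structure IsIID (P : Measure Ω) (μ : Measure Z) (ζ : ℕ → Ω → Z) : Prop where
  measurable : ∀ i, Measurable (ζ i)
  indep : iIndepFun ζ P
  law : ∀ i, P.map (ζ i) = μ

variable {ζ : ℕ → Ω → Z}

lemma IsIID.isProbabilityMeasure (hζ : IsIID P μ ζ) : IsProbabilityMeasure μ := by
  rw [← hζ.law 0]
  exact Measure.isProbabilityMeasure_map (hζ.measurable 0).aemeasurable

/-- Chernoff's method: the centred summand is at most `2 * A` in absolute value, so `2 * A * l ≤ 1`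
permits `exp y ≤ 1 + y + y²` and bounds each moment generating function by `exp (l² v)`. The
parameter `l` stays free because the chaining picks a different one at each scale. -/
lemma IsIID.bernstein_upper (hζ : IsIID P μ ζ) {φ : Z → ℝ} (hφ : Measurable φ) {A v : ℝ}
    (hA : ∀ z, |φ z| ≤ A) (hv : ∫ z, φ z ^ 2 ∂μ ≤ v) {l : ℝ} (hl : 0 ≤ l) (hAl : 2 * A * l ≤ 1)
    (n : ℕ) (x : ℝ) :
    P.real {ω | x ≤ ∑ i ∈ Finset.range n, (φ (ζ i ω) - ∫ z, φ z ∂μ)} ≤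
      Real.exp (-l * x + n * l ^ 2 * v) := by
  have := hζ.isProbabilityMeasure
  set e := ∫ z, φ z ∂μ with he
  have hint : Integrable φ μ := Integrable.of_bound hφ.aestronglyMeasurable A
    (Eventually.of_forall hA)
  have hint2 : Integrable (fun z => φ z ^ 2) μ := by
    refine Integrable.of_bound (hφ.pow_const 2).aestronglyMeasurable (A ^ 2)
      (Eventually.of_forall fun z => ?_)
    rw [Real.norm_eq_abs, abs_pow]
    exact pow_le_pow_left₀ (abs_nonneg _) (hA z) 2
  have heA : |e| ≤ A := by
    have := norm_integral_le_of_norm_le_const (μ := μ) (f := φ) (Eventually.of_forall hA)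
    simpa using this
  have hψ : Measurable fun z => φ z - e := hφ.sub_const e
  have hψA : ∀ z, |φ z - e| ≤ 2 * A := fun z => by
    have := abs_sub (φ z) e
    linarith [hA z]
  have hmgf1 : ∫ z, Real.exp (l * (φ z - e)) ∂μ ≤ Real.exp (l ^ 2 * v) := by
    have hb : ∀ z, Real.exp (l * (φ z - e)) ≤ 1 + l * (φ z - e) + l ^ 2 * (φ z - e) ^ 2 := by
      intro z
      have habs : |l * (φ z - e)| ≤ 1 := by
        rw [abs_mul, abs_of_nonneg hl]
        nlinarith [hψA z]
      have := (abs_le.1 (Real.abs_exp_sub_one_sub_id_le habs)).2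
      nlinarith
    have hi1 : Integrable (fun z => φ z - e) μ := hint.sub (integrable_const e)
    have hi2 : Integrable (fun z => (φ z - e) ^ 2) μ := by
      have : (fun z => (φ z - e) ^ 2) = fun z => φ z ^ 2 - 2 * e * φ z + e ^ 2 := by
        ext z; ring
      rw [this]
      exact (hint2.sub (hint.const_mul _)).add (integrable_const _)
    have e1 : ∫ z, (φ z - e) ∂μ = 0 := by
      rw [integral_sub hint (integrable_const e)]; simp [he]
    have e2 : ∫ z, (φ z - e) ^ 2 ∂μ = ∫ z, φ z ^ 2 ∂μ - e ^ 2 := by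
      have : (fun z => (φ z - e) ^ 2) = fun z => φ z ^ 2 - 2 * e * φ z + e ^ 2 := by
        ext z; ring
      have i1 : Integrable (fun z => φ z ^ 2 - 2 * e * φ z) μ := hint2.sub (hint.const_mul _)
      rw [this, integral_add i1 (integrable_const _),
        integral_sub hint2 (hint.const_mul _), integral_const_mul]
      simp only [integral_const, probReal_univ, one_smul, ← he]
      ring
    have i2 : Integrable (fun z => 1 + l * (φ z - e)) μ :=
      (integrable_const 1).add (hi1.const_mul l)
    calc ∫ z, Real.exp (l * (φ z - e)) ∂μ
        ≤ ∫ z, (1 + l * (φ z - e) + l ^ 2 * (φ z - e) ^ 2) ∂μ := by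
          refine integral_mono_of_nonneg (Eventually.of_forall fun z => (Real.exp_pos _).le) ?_
            (Eventually.of_forall hb)
          exact i2.add (hi2.const_mul _)
      _ = 1 + l ^ 2 * (∫ z, φ z ^ 2 ∂μ - e ^ 2) := by
          rw [integral_add i2 (hi2.const_mul _),
            integral_add (integrable_const 1) (hi1.const_mul l), integral_const_mul,
            integral_const_mul, e1, e2]
          simp
      _ ≤ 1 + l ^ 2 * v := by nlinarith [sq_nonneg l, sq_nonneg e]
      _ ≤ Real.exp (l ^ 2 * v) := by linarith [Real.add_one_le_exp (l ^ 2 * v)]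
  let ξ : ℕ → Ω → ℝ := fun i ω => φ (ζ i ω) - e
  have hξm : ∀ i, Measurable (ξ i) := fun i => hψ.comp (hζ.measurable i)
  have hξi : iIndepFun ξ P := hζ.indep.comp (fun _ z => φ z - e) fun _ => hψ
  have hmgf : ∀ i, mgf (ξ i) P l ≤ Real.exp (l ^ 2 * v) := fun i => by
    have : mgf (ξ i) P l = ∫ z, Real.exp (l * (φ z - e)) ∂μ := by
      rw [← hζ.law i, integral_map (hζ.measurable i).aemeasurable]
      · rfl
      · exact (by fun_prop : Measurable fun z => Real.exp (l * (φ z - e))).aestronglyMeasurable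
    rw [this]; exact hmgf1
  have hchern := measure_ge_le_exp_mul_mgf (μ := P) (X := ∑ i ∈ Finset.range n, ξ i) x hl (by
    refine Integrable.of_bound (C := Real.exp (l * (n * (2 * A)))) ?_ ?_
    · refine Measurable.aestronglyMeasurable ?_
      have := Finset.measurable_sum (Finset.range n) fun i _ => hξm i
      fun_prop
    · refine Eventually.of_forall fun ω => ?_
      rw [Real.norm_of_nonneg (Real.exp_pos _).le, Finset.sum_apply]
      refine Real.exp_le_exp.2 (mul_le_mul_of_nonneg_left ?_ hl)
      calc ∑ i ∈ Finset.range n, ξ i ω ≤ ∑ i ∈ Finset.range n, 2 * A :=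
            Finset.sum_le_sum fun i _ => (le_abs_self _).trans (hψA _)
        _ = n * (2 * A) := by simp)
  rw [hξi.mgf_sum hξm] at hchern
  have hprod : ∏ i ∈ Finset.range n, mgf (ξ i) P l ≤ Real.exp (n * l ^ 2 * v) := by
    calc ∏ i ∈ Finset.range n, mgf (ξ i) P l ≤ ∏ i ∈ Finset.range n, Real.exp (l ^ 2 * v) :=
          Finset.prod_le_prod (fun i _ => mgf_nonneg) fun i _ => hmgf i
      _ = Real.exp (n * l ^ 2 * v) := by
          rw [Finset.prod_const, Finset.card_range, ← Real.exp_nat_mul, mul_assoc]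
  have hset : {ω | x ≤ ∑ i ∈ Finset.range n, (φ (ζ i ω) - e)} =
      {ω | x ≤ (∑ i ∈ Finset.range n, ξ i) ω} := by
    ext ω; simp [ξ, Finset.sum_apply]
  rw [hset]
  refine hchern.trans ?_
  rw [Real.exp_add]
  exact mul_le_mul_of_nonneg_left hprod (Real.exp_pos _).le

/-- Bernstein's inequality, before optimization over the exponential parameter. -/
lemma IsIID.bernstein (hζ : IsIID P μ ζ) {φ : Z → ℝ} (hφ : Measurable φ) {A v : ℝ}
    (hA : ∀ z, |φ z| ≤ A) (hv : ∫ z, φ z ^ 2 ∂μ ≤ v) {l : ℝ} (hl : 0 ≤ l) (hAl : 2 * A * l ≤ 1)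
    (n : ℕ) (x : ℝ) :
    P {ω | x < |∑ i ∈ Finset.range n, (φ (ζ i ω) - ∫ z, φ z ∂μ)|} ≤
      ENNReal.ofReal (2 * Real.exp (-l * x + n * l ^ 2 * v)) := by
  have h1 := hζ.bernstein_upper hφ hA hv hl hAl n x
  have h2 := hζ.bernstein_upper hφ.neg (by simpa using hA) (by simpa using hv) hl hAl n x
  rw [two_mul, ENNReal.ofReal_add (Real.exp_pos _).le (Real.exp_pos _).le]
  have hsub : {ω | x < |∑ i ∈ Finset.range n, (φ (ζ i ω) - ∫ z, φ z ∂μ)|} ⊆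
      {ω | x ≤ ∑ i ∈ Finset.range n, (φ (ζ i ω) - ∫ z, φ z ∂μ)} ∪
      {ω | x ≤ ∑ i ∈ Finset.range n, ((-φ) (ζ i ω) - ∫ z, (-φ) z ∂μ)} := by
    intro ω hω
    simp only [Set.mem_ofPred_eq] at hω
    rcases lt_abs.1 hω with h | h
    · exact Or.inl h.le
    · refine Or.inr ?_
      simp only [Set.mem_ofPred_eq, Pi.neg_apply, integral_neg]
      refine h.le.trans (le_of_eq ?_)
      rw [← Finset.sum_neg_distrib]
      exact Finset.sum_congr rfl fun i _ => by ring
  refine (measure_mono hsub).trans ((measure_union_le _ _).trans (add_le_add ?_ ?_))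
  · rw [← ofReal_measureReal]; exact ENNReal.ofReal_le_ofReal h1
  · rw [← ofReal_measureReal]; exact ENNReal.ofReal_le_ofReal h2

/-- Markov's inequality for averages of a nonnegative function. -/
lemma IsIID.measure_average_gt_le (hζ : IsIID P μ ζ) {φ : Z → ℝ} (hφ : Integrable φ μ)
    (hφ0 : ∀ z, 0 ≤ φ z) {n : ℕ} (hn : 0 < n) {L : ℝ} (hL : 0 < L) :
    P {ω | L < (n : ℝ)⁻¹ * ∑ i ∈ Finset.range n, φ (ζ i ω)} ≤
      ENNReal.ofReal ((∫ z, φ z ∂μ) / L) := by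
  have hmp : ∀ i, MeasurePreserving (ζ i) P μ := fun i => ⟨hζ.measurable i, hζ.law i⟩
  have hi : ∀ i, Integrable (fun ω => φ (ζ i ω)) P := fun i =>
    (hmp i).integrable_comp_of_integrable hφ
  have hint : Integrable (fun ω => (n : ℝ)⁻¹ * ∑ i ∈ Finset.range n, φ (ζ i ω)) P :=
    (integrable_finsetSum _ fun i _ => hi i).const_mul _
  have hn' : (n : ℝ) ≠ 0 := by positivity
  have heq : ∫ ω, (n : ℝ)⁻¹ * ∑ i ∈ Finset.range n, φ (ζ i ω) ∂P = ∫ z, φ z ∂μ := by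
    rw [integral_const_mul, integral_finsetSum _ fun i _ => hi i]
    have : ∀ i, ∫ ω, φ (ζ i ω) ∂P = ∫ z, φ z ∂μ := fun i => by
      rw [← hζ.law i, integral_map (hζ.measurable i).aemeasurable]
      rw [hζ.law i]; exact hφ.aestronglyMeasurable
    simp only [this, Finset.sum_const, Finset.card_range, nsmul_eq_mul]
    field_simp
  have hnn : 0 ≤ᵐ[P] fun ω => (n : ℝ)⁻¹ * ∑ i ∈ Finset.range n, φ (ζ i ω) :=
    Eventually.of_forall fun ω => mul_nonneg (by positivity) (Finset.sum_nonneg fun i _ => hφ0 _)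
  have hm := mul_meas_ge_le_integral_of_nonneg hnn hint L
  rw [heq] at hm
  refine (measure_mono (t := {ω | L ≤ (n : ℝ)⁻¹ * ∑ i ∈ Finset.range n, φ (ζ i ω)})
    fun ω (hω : L < _) => hω.le).trans ?_
  rw [← ofReal_measureReal]
  refine ENNReal.ofReal_le_ofReal ?_
  rw [le_div_iff₀ hL, mul_comm]
  exact hm

end Bernstein

/-! ### Size and Lipschitz bounds for the Gaussian kernel. -/

section Kernel

lemma Kh_nonneg {h : ℝ} (hh : 0 < h) (t : ℝ) : 0 ≤ Kh h t :=
  mul_nonneg (inv_nonneg.2 hh.le) (gaussianPDFReal_nonneg _ _ _)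

lemma measurable_Kh (h : ℝ) : Measurable (Kh h) := by unfold Kh; fun_prop

lemma continuous_gaussianPDFReal_std : Continuous (gaussianPDFReal 0 1) := by
  unfold gaussianPDFReal; fun_prop

lemma continuous_Kh (h : ℝ) : Continuous (Kh h) := by
  have := continuous_gaussianPDFReal_std
  unfold Kh; fun_prop

lemma Kh_eq (h t : ℝ) :
    Kh h t = h⁻¹ * ((Real.sqrt (2 * Real.pi))⁻¹ * Real.exp (-(t / h) ^ 2 / 2)) := by
  simp [Kh, gaussianPDFReal]

lemma inv_sqrt_two_pi_le_one : (Real.sqrt (2 * Real.pi))⁻¹ ≤ 1 := by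
  refine inv_le_one_of_one_le₀ ?_
  rw [Real.one_le_sqrt]
  linarith [Real.pi_gt_three]

lemma Kh_le {h : ℝ} (hh : 0 < h) (t : ℝ) : Kh h t ≤ h⁻¹ := by
  rw [Kh_eq]
  have h1 : Real.exp (-(t / h) ^ 2 / 2) ≤ 1 := by
    rw [Real.exp_le_one_iff]; nlinarith [sq_nonneg (t / h)]
  have h2 := inv_sqrt_two_pi_le_one
  have h3 : (Real.sqrt (2 * Real.pi))⁻¹ * Real.exp (-(t / h) ^ 2 / 2) ≤ 1 :=
    mul_le_one₀ h2 (Real.exp_pos _).le h1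
  have := inv_pos.2 hh
  nlinarith

lemma abs_Kh_sub_Kh_le_inv {h : ℝ} (hh : 0 < h) (s t : ℝ) : |Kh h s - Kh h t| ≤ h⁻¹ := by
  rw [abs_le]
  constructor <;> linarith [Kh_nonneg hh s, Kh_nonneg hh t, Kh_le hh s, Kh_le hh t]

lemma abs_Kh_sub_Kh_le {h : ℝ} (hh : 0 < h) (s t : ℝ) :
    |Kh h s - Kh h t| ≤ (h ^ 2)⁻¹ * |s - t| := by
  have hd : ∀ x, HasDerivAt (fun x : ℝ => Real.exp (-x ^ 2 / 2))
      (Real.exp (-x ^ 2 / 2) * (-x)) x := fun x => by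
    have := (((hasDerivAt_pow 2 x).neg).div_const 2).exp
    refine this.congr_deriv ?_
    simp; ring
  have hb : ∀ x : ℝ, ‖Real.exp (-x ^ 2 / 2) * (-x)‖ ≤ 1 := fun x => by
    rw [norm_mul, norm_neg, Real.norm_of_nonneg (Real.exp_pos _).le, Real.norm_eq_abs]
    -- `|x| ≤ 1 + x² / 2 ≤ exp (x² / 2)`, which bounds the derivative of the Gaussian by one.
    have h1 : |x| ≤ Real.exp (x ^ 2 / 2) := by
      have := Real.add_one_le_exp (x ^ 2 / 2)
      nlinarith [sq_nonneg (|x| - 1), sq_abs x]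
    calc Real.exp (-x ^ 2 / 2) * |x| ≤ Real.exp (-x ^ 2 / 2) * Real.exp (x ^ 2 / 2) :=
          mul_le_mul_of_nonneg_left h1 (Real.exp_pos _).le
      _ = 1 := by rw [← Real.exp_add]; simp [neg_div]
  have hL := convex_univ.norm_image_sub_le_of_norm_hasDerivWithin_le (𝕜 := ℝ)
    (f := fun x : ℝ => Real.exp (-x ^ 2 / 2)) (C := 1)
    (fun x _ => (hd x).hasDerivWithinAt) (fun x _ => hb x)
    (Set.mem_univ (t / h)) (Set.mem_univ (s / h))
  rw [Real.norm_eq_abs, Real.norm_eq_abs, ← sub_div, abs_div, abs_of_pos hh, one_mul] at hL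
  rw [Kh_eq, Kh_eq, ← mul_sub, ← mul_sub, abs_mul, abs_mul, abs_of_pos (inv_pos.2 hh),
    abs_of_nonneg (by positivity : 0 ≤ (Real.sqrt (2 * Real.pi))⁻¹)]
  have h2 := inv_sqrt_two_pi_le_one
  calc h⁻¹ * ((Real.sqrt (2 * Real.pi))⁻¹ *
        |Real.exp (-(s / h) ^ 2 / 2) - Real.exp (-(t / h) ^ 2 / 2)|)
      ≤ h⁻¹ * (1 * (|s - t| / h)) := by gcongr
    _ = (h ^ 2)⁻¹ * |s - t| := by field_simp

/-- Translations of `K_h` are Lipschitz in `L²` with constant `h ^ (-3/2)`. -/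
lemma lintegral_sq_Kh_sub_le {h : ℝ} (hh : 0 < h) (a b : ℝ) :
    ∫⁻ s, ENNReal.ofReal ((Kh h (s - a) - Kh h (s - b)) ^ 2) ≤
      ENNReal.ofReal ((h ^ 3)⁻¹ * (a - b) ^ 2) := by
  have hb : 0 < (h ^ 2)⁻¹ := by positivity
  have hpi := Real.pi_pos
  have hgi : ∀ c, Integrable (fun s : ℝ => Real.exp (-(h ^ 2)⁻¹ * (s - c) ^ 2)) := fun c =>
    (integrable_exp_neg_mul_sq hb).comp_sub_right c
  have hgv : ∀ c, ∫ s : ℝ, Real.exp (-(h ^ 2)⁻¹ * (s - c) ^ 2) = h * Real.sqrt Real.pi :=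
    fun c => by
      rw [integral_sub_right_eq_self (fun s : ℝ => Real.exp (-(h ^ 2)⁻¹ * s ^ 2)) c,
        integral_gaussian, div_inv_eq_mul, Real.sqrt_mul hpi.le, Real.sqrt_sq hh.le, mul_comm]
  set E := Real.exp (-((a - b) ^ 2 / (4 * h ^ 2))) with hE
  -- Completing the square, the product of Gaussians centred at `a` and `b` is `E` times one centred
  -- at the midpoint. The `L²` norm is then an explicit multiple of `1 - E`, and `1 - exp (-y) ≤ y`
  -- finishes.
  have hexp : ∀ s, (Kh h (s - a) - Kh h (s - b)) ^ 2 = ((h ^ 2)⁻¹ * (2 * Real.pi)⁻¹) *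
      (Real.exp (-(h ^ 2)⁻¹ * (s - a) ^ 2) + Real.exp (-(h ^ 2)⁻¹ * (s - b) ^ 2) -
        2 * E * Real.exp (-(h ^ 2)⁻¹ * (s - (a + b) / 2) ^ 2)) := by
    intro s
    have e1 : Real.exp (-((s - a) / h) ^ 2 / 2) ^ 2 = Real.exp (-(h ^ 2)⁻¹ * (s - a) ^ 2) := by
      rw [← Real.exp_nat_mul]; congr 1; field_simp; push_cast; ring
    have e2 : Real.exp (-((s - b) / h) ^ 2 / 2) ^ 2 = Real.exp (-(h ^ 2)⁻¹ * (s - b) ^ 2) := by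
      rw [← Real.exp_nat_mul]; congr 1; field_simp; push_cast; ring
    have e3 : Real.exp (-((s - a) / h) ^ 2 / 2) * Real.exp (-((s - b) / h) ^ 2 / 2) =
        E * Real.exp (-(h ^ 2)⁻¹ * (s - (a + b) / 2) ^ 2) := by
      rw [hE, ← Real.exp_add, ← Real.exp_add]; congr 1; field_simp; ring
    have e4 : (Real.sqrt (2 * Real.pi))⁻¹ ^ 2 = (2 * Real.pi)⁻¹ := by
      rw [inv_pow, Real.sq_sqrt (by positivity)]
    rw [Kh_eq, Kh_eq, ← e1, ← e2, mul_assoc 2, ← e3, ← e4]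
    ring
  have hInt : Integrable (fun s => (Kh h (s - a) - Kh h (s - b)) ^ 2) := by
    simp_rw [hexp]
    exact (((hgi a).add (hgi b)).sub ((hgi _).const_mul _)).const_mul _
  rw [← ofReal_integral_eq_lintegral_ofReal hInt (Eventually.of_forall fun _ => sq_nonneg _)]
  refine ENNReal.ofReal_le_ofReal ?_
  simp_rw [hexp]
  have i1 : Integrable (fun s : ℝ => Real.exp (-(h ^ 2)⁻¹ * (s - a) ^ 2) +
      Real.exp (-(h ^ 2)⁻¹ * (s - b) ^ 2)) := (hgi a).add (hgi b)
  rw [integral_const_mul, integral_sub i1 ((hgi _).const_mul _),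
    integral_add (hgi a) (hgi b), integral_const_mul, hgv, hgv, hgv]
  have h1E : 1 - E ≤ (a - b) ^ 2 / (4 * h ^ 2) := by
    have := Real.add_one_le_exp (-((a - b) ^ 2 / (4 * h ^ 2)))
    linarith
  have hsq : Real.sqrt Real.pi ≤ Real.pi := by
    rw [Real.sqrt_le_left hpi.le]; nlinarith [Real.pi_gt_three]
  have hfac : 0 ≤ (h ^ 2)⁻¹ * (2 * Real.pi)⁻¹ * (2 * (h * Real.sqrt Real.pi)) := by positivity
  calc (h ^ 2)⁻¹ * (2 * Real.pi)⁻¹ *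
        (h * Real.sqrt Real.pi + h * Real.sqrt Real.pi - 2 * E * (h * Real.sqrt Real.pi))
      = ((h ^ 2)⁻¹ * (2 * Real.pi)⁻¹ * (2 * (h * Real.sqrt Real.pi))) * (1 - E) := by ring
    _ ≤ ((h ^ 2)⁻¹ * (2 * Real.pi)⁻¹ * (2 * (h * Real.sqrt Real.pi))) *
          ((a - b) ^ 2 / (4 * h ^ 2)) := mul_le_mul_of_nonneg_left h1E hfac
    _ = ((h ^ 3)⁻¹ * (a - b) ^ 2) * (Real.sqrt Real.pi / Real.pi / 4) := by field_simp
    _ ≤ ((h ^ 3)⁻¹ * (a - b) ^ 2) * 1 := by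
        refine mul_le_mul_of_nonneg_left ?_ (by positivity)
        have : Real.sqrt Real.pi / Real.pi ≤ 1 := (div_le_one hpi).2 hsq
        linarith
    _ = _ := mul_one _

end Kernel

/-! ### Nets of the unit ball and chaining. -/

section Chaining

variable {q : ℕ}

/-- Points are grouped by the cell of a cubic grid that contains them, and one point of the ball is
kept from each occupied cell, so the net stays inside the ball. -/
lemma exists_finset_net (q N : ℕ) (hN : 0 < N) :
    ∃ L : Finset (E q), (∀ a ∈ L, ‖a‖ ≤ 1) ∧
      (∀ u : E q, ‖u‖ ≤ 1 → ∃ a ∈ L, ‖u - a‖ ≤ (N : ℝ)⁻¹) ∧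
      (L.card : ℝ) ≤ (3 * (q + 1) : ℝ) ^ q * (N : ℝ) ^ q := by
  classical
  -- Cells of side `1 / R` have diameter at most `√q / R ≤ 1 / N`.
  set R : ℕ := N * (q + 1) with hR
  have hR0 : (0 : ℝ) < R := by
    have : 0 < R := by positivity
    exact_mod_cast this
  let fl : E q → Fin q → ℤ := fun u i => ⌊R * u i⌋
  let S : Finset (Fin q → ℤ) := Fintype.piFinset fun _ => Finset.Icc (-(R : ℤ)) R
  have hmem : ∀ u : E q, ‖u‖ ≤ 1 → fl u ∈ S := by
    intro u hu
    rw [Fintype.mem_piFinset]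
    intro i
    have hi : |u i| ≤ 1 := (PiLp.norm_apply_le u i).trans hu
    have hi' := abs_le.1 hi
    rw [Finset.mem_Icc]
    constructor
    · rw [Int.le_floor]; push_cast; nlinarith
    · have : (⌊R * u i⌋ : ℝ) ≤ R := (Int.floor_le _).trans (by nlinarith)
      exact_mod_cast this
  let T : Finset (Fin q → ℤ) := S.filter fun j => ∃ u : E q, ‖u‖ ≤ 1 ∧ fl u = j
  have hT : ∀ j ∈ T, ∃ u : E q, ‖u‖ ≤ 1 ∧ fl u = j := fun j hj => (Finset.mem_filter.1 hj).2
  choose! g hg using hT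
  refine ⟨T.image g, ?_, ?_, ?_⟩
  · intro a ha
    obtain ⟨j, hj, rfl⟩ := Finset.mem_image.1 ha
    exact (hg j hj).1
  · intro u hu
    have hj : fl u ∈ T := Finset.mem_filter.2 ⟨hmem u hu, u, hu, rfl⟩
    refine ⟨g (fl u), Finset.mem_image_of_mem _ hj, ?_⟩
    have hfl := (hg _ hj).2
    have hcoord : ∀ i, ‖(u - g (fl u)) i‖ ^ 2 ≤ ((R : ℝ)⁻¹) ^ 2 := by
      intro i
      have h1 : (⌊R * (g (fl u)) i⌋ : ℤ) = ⌊R * u i⌋ := congrFun hfl i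
      have h2 := Int.abs_sub_lt_one_of_floor_eq_floor h1
      refine pow_le_pow_left₀ (norm_nonneg _) ?_ 2
      rw [Real.norm_eq_abs, PiLp.sub_apply, ← one_div, le_div_iff₀ hR0]
      rw [← mul_sub, abs_mul, abs_of_pos hR0, abs_sub_comm] at h2
      linarith
    rw [EuclideanSpace.norm_eq]
    refine Real.sqrt_le_iff.2 ⟨by positivity, ?_⟩
    calc ∑ i, ‖(u - g (fl u)) i‖ ^ 2 ≤ ∑ _i : Fin q, ((R : ℝ)⁻¹) ^ 2 :=
          Finset.sum_le_sum fun i _ => hcoord i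
      _ = q * ((R : ℝ)⁻¹) ^ 2 := by simp
      _ ≤ (q + 1 : ℝ) ^ 2 * ((R : ℝ)⁻¹) ^ 2 := by
          refine mul_le_mul_of_nonneg_right ?_ (sq_nonneg _)
          have : (0 : ℝ) ≤ q := Nat.cast_nonneg q
          nlinarith
      _ = ((N : ℝ)⁻¹) ^ 2 := by
          rw [hR]; push_cast; field_simp
  · have h1 : (T.image g).card ≤ (2 * R + 1) ^ q := by
      refine Finset.card_image_le.trans ((Finset.card_filter_le _ _).trans (le_of_eq ?_))
      rw [Fintype.card_piFinset]
      simp only [Int.card_Icc, Finset.prod_const, Finset.card_univ, Fintype.card_fin]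
      congr 1
      omega
    calc ((T.image g).card : ℝ) ≤ ((2 * R + 1 : ℕ) : ℝ) ^ q := by exact_mod_cast h1
      _ ≤ (3 * (R : ℝ)) ^ q := by
          refine pow_le_pow_left₀ (by positivity) ?_ q
          have : (1 : ℝ) ≤ R := by
            have : 0 < R := by positivity
            exact_mod_cast this
          push_cast; linarith
      _ = (3 * (q + 1) : ℝ) ^ q * (N : ℝ) ^ q := by
          rw [← mul_pow, hR]; push_cast; ring

/-- Nets of the unit ball at the scales `16⁻ᵏ`, the coarsest one being `{0}`. -/
lemma exists_net_sequence (q : ℕ) : ∃ A : ℝ, 1 ≤ A ∧ ∃ L : ℕ → Finset (E q), L 0 = {0} ∧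
    (∀ k, ∀ a ∈ L k, ‖a‖ ≤ 1) ∧
    (∀ k, ∀ u : E q, ‖u‖ ≤ 1 → ∃ a ∈ L k, ‖u - a‖ ≤ ((16 : ℝ) ^ k)⁻¹) ∧
    ∀ k, ((L k).card : ℝ) ≤ A * ((16 : ℝ) ^ k) ^ q := by
  have h := fun k : ℕ => exists_finset_net q (16 ^ k) (by positivity)
  choose L h1 h2 h3 using h
  have hA : (1 : ℝ) ≤ (3 * (q + 1) : ℝ) ^ q := by
    refine one_le_pow₀ ?_
    have : (0 : ℝ) ≤ q := Nat.cast_nonneg q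
    linarith
  refine ⟨(3 * (q + 1) : ℝ) ^ q, hA, fun k => if k = 0 then {0} else L k, by simp, ?_, ?_, ?_⟩
  · intro k a ha
    rcases eq_or_ne k 0 with rfl | hk
    · simp at ha; simp [ha]
    · simp only [hk, if_false] at ha; exact h1 k a ha
  · intro k u hu
    rcases eq_or_ne k 0 with rfl | hk
    · exact ⟨0, by simp, by simpa using hu⟩
    · simp only [hk, if_false]
      simpa using h2 k u hu
  · intro k
    rcases eq_or_ne k 0 with rfl | hk
    · simpa using hA
    · simp only [hk, if_false]
      simpa using h3 k

/-- Telescoping through approximations of `u` in successive nets, from `0` at level zero to level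
`K`; consecutive ones differ by at most `16⁻ᵏ + 16⁻⁽ᵏ⁺¹⁾ ≤ 2 · 16⁻ᵏ`. The last link, from `u` to its
level-`K` approximation, costs `y`. -/
lemma abs_sub_le_of_chain {f : E q → ℝ} {L : ℕ → Finset (E q)} (hL0 : L 0 = {0})
    (hL1 : ∀ k, ∀ a ∈ L k, ‖a‖ ≤ 1)
    (hL : ∀ k, ∀ u : E q, ‖u‖ ≤ 1 → ∃ a ∈ L k, ‖u - a‖ ≤ ((16 : ℝ) ^ k)⁻¹) {x : ℕ → ℝ} {K : ℕ}
    (hx : ∀ k < K, ∀ a ∈ L k, ∀ b ∈ L (k + 1), ‖a - b‖ ≤ 2 * ((16 : ℝ) ^ k)⁻¹ →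
      |f a - f b| ≤ x k) {y : ℝ}
    (hy : ∀ u v : E q, ‖u‖ ≤ 1 → ‖v‖ ≤ 1 → ‖u - v‖ ≤ ((16 : ℝ) ^ K)⁻¹ → |f u - f v| ≤ y)
    {u : E q} (hu : ‖u‖ ≤ 1) : |f u - f 0| ≤ ∑ k ∈ Finset.range K, x k + y := by
  choose a ha hau using fun k => hL k u hu
  have ha0 : a 0 = 0 := by
    have := ha 0
    rwa [hL0, Finset.mem_singleton] at this
  have h1 := dist_le_range_sum_of_dist_le (f := fun k => f (a k)) K (d := x) fun {k} hk => by
    rw [Real.dist_eq]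
    refine hx k hk _ (ha k) _ (ha (k + 1)) ?_
    have e : a k - a (k + 1) = (u - a (k + 1)) - (u - a k) := by abel
    rw [e]
    refine (norm_sub_le _ _).trans ?_
    have h16 : ((16 : ℝ) ^ (k + 1))⁻¹ ≤ ((16 : ℝ) ^ k)⁻¹ := by
      refine inv_anti₀ (by positivity) ?_
      exact pow_le_pow_right₀ (by norm_num) (Nat.le_succ k)
    linarith [hau k, hau (k + 1)]
  have h2 := hy u (a K) hu (hL1 K _ (ha K)) (hau K)
  simp only [ha0, Real.dist_eq] at h1
  have h3 : |f u - f 0| ≤ |f u - f (a K)| + |f (a K) - f 0| := abs_sub_le _ _ _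
  rw [abs_sub_comm (f 0)] at h1
  linarith

/-- The number of pairs at level `k` grows like `2 ^ (8qk)`, while the tail `exp (-(2 ^ k t))` is
smaller than any power of `2 ^ k t`. -/
lemma chaining_sum_le {q : ℕ} {t : ℝ} (ht : 1 ≤ t) (K : ℕ) :
    ∑ k ∈ Finset.range K, ((16 : ℝ) ^ k) ^ q * ((16 : ℝ) ^ (k + 1)) ^ q * Real.exp (-(2 ^ k * t)) ≤
      2 * 16 ^ q * (Nat.factorial (8 * q + 1)) / t := by
  have ht0 : 0 < t := by linarith
  set F : ℝ := (Nat.factorial (8 * q + 1) : ℝ) with hF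
  have hF0 : 0 < F := by positivity
  have hterm : ∀ k : ℕ, ((16 : ℝ) ^ k) ^ q * ((16 : ℝ) ^ (k + 1)) ^ q *
      Real.exp (-(2 ^ k * t)) ≤ (16 ^ q * F / t) * (1 / 2) ^ k := by
    intro k
    -- The power `8q + 1` absorbs the pair count and leaves one further factor `2⁻ᵏ` for a geometric
    -- series; `t ≤ t ^ (8q + 1)` yields the `1 / t`.
    have hp := Real.pow_div_factorial_le_exp (2 ^ k * t) (by positivity) (8 * q + 1)
    rw [div_le_iff₀ (by positivity)] at hp
    have hsplit : (2 ^ k * t) ^ (8 * q + 1) =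
        (((16 : ℝ) ^ k) ^ q * ((16 : ℝ) ^ k) ^ q) * 2 ^ k * t ^ (8 * q + 1) := by
      have : (16 : ℝ) = 2 ^ 4 := by norm_num
      rw [this]
      simp only [mul_pow, ← pow_mul, ← pow_add]
      congr 2
      ring
    have htp : t ≤ t ^ (8 * q + 1) := le_self_pow₀ ht (by omega)
    have h1 : (((16 : ℝ) ^ k) ^ q * ((16 : ℝ) ^ k) ^ q) * 2 ^ k * t ≤
        Real.exp (2 ^ k * t) * F := by
      refine le_trans ?_ hp
      rw [hsplit]
      exact mul_le_mul_of_nonneg_left htp (by positivity)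
    have h16 : ((16 : ℝ) ^ (k + 1)) ^ q = ((16 : ℝ) ^ k) ^ q * 16 ^ q := by
      rw [pow_succ, mul_pow]
    rw [Real.exp_neg, h16, ← div_eq_mul_inv, div_le_iff₀ (Real.exp_pos _), one_div, inv_pow]
    have h2 : 16 ^ q * F / t * ((2 : ℝ) ^ k)⁻¹ * Real.exp (2 ^ k * t) =
        16 ^ q * (Real.exp (2 ^ k * t) * F) / (2 ^ k * t) := by
      field_simp
    rw [h2, le_div_iff₀ (by positivity)]
    calc ((16 : ℝ) ^ k) ^ q * (((16 : ℝ) ^ k) ^ q * 16 ^ q) * (2 ^ k * t)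
        = 16 ^ q * ((((16 : ℝ) ^ k) ^ q * ((16 : ℝ) ^ k) ^ q) * 2 ^ k * t) := by ring
      _ ≤ _ := mul_le_mul_of_nonneg_left h1 (by positivity)
  calc _ ≤ ∑ k ∈ Finset.range K, (16 ^ q * F / t) * (1 / 2 : ℝ) ^ k :=
        Finset.sum_le_sum fun k _ => hterm k
    _ = (16 ^ q * F / t) * ∑ k ∈ Finset.range K, (1 / 2 : ℝ) ^ k := by rw [Finset.mul_sum]
    _ ≤ (16 ^ q * F / t) * 2 := by
        refine mul_le_mul_of_nonneg_left ?_ (by positivity)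
        exact sum_geometric_two_le K
    _ = _ := by ring

/-- Chaining over the unit ball with exponential increment bounds down to the scale `16⁻ᴷ`. -/
lemma exists_chaining_const (q : ℕ) : ∃ C₁ : ℝ, 0 < C₁ ∧
    ∀ {Ω : Type*} [MeasurableSpace Ω] (P : Measure Ω) (D : Ω → E q → ℝ) (K : ℕ) (s t b y : ℝ),
      0 ≤ s → 1 ≤ t → 0 ≤ b →
      (∀ k < K, ∀ u v : E q, ‖u‖ ≤ 1 → ‖v‖ ≤ 1 → ‖u - v‖ ≤ 2 * ((16 : ℝ) ^ k)⁻¹ →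
        P {ω | s * (1 / 2) ^ k < |D ω u - D ω v|} ≤ ENNReal.ofReal (b * Real.exp (-(2 ^ k * t)))) →
      P {ω | (∀ u v : E q, ‖u‖ ≤ 1 → ‖v‖ ≤ 1 → ‖u - v‖ ≤ ((16 : ℝ) ^ K)⁻¹ →
          |D ω u - D ω v| ≤ y) ∧ ∃ u : E q, ‖u‖ ≤ 1 ∧ 2 * s + y < |D ω u - D ω 0|} ≤
        ENNReal.ofReal (C₁ * b / t) := by
  obtain ⟨A, hA, L, hL0, hL1, hL, hcard⟩ := exists_net_sequence q
  refine ⟨A ^ 2 * (2 * 16 ^ q * (Nat.factorial (8 * q + 1))), by positivity, ?_⟩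
  intro Ω _ P D K s t b y hs ht hb hinc
  -- With the distance condition inside the event, pairs that are too far apart contribute the empty
  -- set and the union may run over all pairs.
  let bad : ℕ → E q → E q → Set Ω := fun k u v =>
    {ω | ‖u - v‖ ≤ 2 * ((16 : ℝ) ^ k)⁻¹ ∧ s * (1 / 2) ^ k < |D ω u - D ω v|}
  have hsub : {ω | (∀ u v : E q, ‖u‖ ≤ 1 → ‖v‖ ≤ 1 → ‖u - v‖ ≤ ((16 : ℝ) ^ K)⁻¹ →
      |D ω u - D ω v| ≤ y) ∧ ∃ u : E q, ‖u‖ ≤ 1 ∧ 2 * s + y < |D ω u - D ω 0|} ⊆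
      ⋃ k ∈ Finset.range K, ⋃ u ∈ L k, ⋃ v ∈ L (k + 1), bad k u v := by
    rintro ω ⟨hω, u, hu, hbig⟩
    by_contra hcon
    simp only [Set.mem_iUnion, not_exists] at hcon
    have := abs_sub_le_of_chain (f := D ω) hL0 hL1 hL (x := fun k => s * (1 / 2) ^ k) (K := K)
      (fun k hk a ha b hb hab => by
        by_contra hlt
        exact hcon k (Finset.mem_range.2 hk) a ha b hb ⟨hab, not_le.1 hlt⟩) hω hu
    rw [← Finset.mul_sum] at this
    have := mul_le_mul_of_nonneg_left (sum_geometric_two_le K) hs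
    linarith
  have hbad : ∀ k < K, ∀ u ∈ L k, ∀ v ∈ L (k + 1),
      P (bad k u v) ≤ ENNReal.ofReal (b * Real.exp (-(2 ^ k * t))) := by
    intro k hk u hu v hv
    by_cases huv : ‖u - v‖ ≤ 2 * ((16 : ℝ) ^ k)⁻¹
    · refine (measure_mono ?_).trans (hinc k hk u v (hL1 k u hu) (hL1 _ v hv) huv)
      exact fun ω hω => hω.2
    · have : bad k u v = ∅ := by
        ext ω; simp [bad, huv]
      simp [this]
  have hlevel : ∀ k < K, P (⋃ u ∈ L k, ⋃ v ∈ L (k + 1), bad k u v) ≤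
      ENNReal.ofReal (A ^ 2 * b * (((16 : ℝ) ^ k) ^ q * ((16 : ℝ) ^ (k + 1)) ^ q *
        Real.exp (-(2 ^ k * t)))) := by
    intro k hk
    calc P (⋃ u ∈ L k, ⋃ v ∈ L (k + 1), bad k u v)
        ≤ ∑ u ∈ L k, ∑ v ∈ L (k + 1), P (bad k u v) :=
          (measure_biUnion_finset_le _ _).trans
            (Finset.sum_le_sum fun u _ => measure_biUnion_finset_le _ _)
      _ ≤ ∑ u ∈ L k, ∑ v ∈ L (k + 1), ENNReal.ofReal (b * Real.exp (-(2 ^ k * t))) :=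
          Finset.sum_le_sum fun u hu => Finset.sum_le_sum fun v hv => hbad k hk u hu v hv
      _ = ENNReal.ofReal ((L k).card * ((L (k + 1)).card * (b * Real.exp (-(2 ^ k * t))))) := by
          rw [ENNReal.ofReal_mul (Nat.cast_nonneg _), ENNReal.ofReal_mul (Nat.cast_nonneg _)]
          simp only [Finset.sum_const, nsmul_eq_mul, ENNReal.ofReal_natCast]
      _ ≤ _ := by
          refine ENNReal.ofReal_le_ofReal ?_
          have h1 := hcard k
          have h2 := hcard (k + 1)
          have he : 0 ≤ b * Real.exp (-(2 ^ k * t)) := mul_nonneg hb (Real.exp_pos _).le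
          calc ((L k).card : ℝ) * ((L (k + 1)).card * (b * Real.exp (-(2 ^ k * t))))
              ≤ (A * ((16 : ℝ) ^ k) ^ q) * ((A * ((16 : ℝ) ^ (k + 1)) ^ q) *
                  (b * Real.exp (-(2 ^ k * t)))) := by gcongr
            _ = _ := by ring
  calc _ ≤ P (⋃ k ∈ Finset.range K, ⋃ u ∈ L k, ⋃ v ∈ L (k + 1), bad k u v) := measure_mono hsub
    _ ≤ ∑ k ∈ Finset.range K, P (⋃ u ∈ L k, ⋃ v ∈ L (k + 1), bad k u v) :=
        measure_biUnion_finset_le _ _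
    _ ≤ ∑ k ∈ Finset.range K, ENNReal.ofReal (A ^ 2 * b * (((16 : ℝ) ^ k) ^ q *
          ((16 : ℝ) ^ (k + 1)) ^ q * Real.exp (-(2 ^ k * t)))) :=
        Finset.sum_le_sum fun k hk => hlevel k (Finset.mem_range.1 hk)
    _ = ENNReal.ofReal (∑ k ∈ Finset.range K, A ^ 2 * b * (((16 : ℝ) ^ k) ^ q *
          ((16 : ℝ) ^ (k + 1)) ^ q * Real.exp (-(2 ^ k * t)))) := by
        rw [ENNReal.ofReal_sum_of_nonneg fun k _ => by positivity]
    _ ≤ _ := by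
        refine ENNReal.ofReal_le_ofReal ?_
        rw [← Finset.mul_sum]
        refine (mul_le_mul_of_nonneg_left (chaining_sum_le ht K) (by positivity)).trans
          (le_of_eq ?_)
        ring

end Chaining

/-! ### Measurable selection of a maximizer. -/

section MeasurableArgmax

variable {Ω X : Type*} [MeasurableSpace Ω] [MetricSpace X]

/-- The maximizers of `f` over `S`. -/
def argmaxSet (S : Set X) (f : X → ℝ) : Set X := {x ∈ S | ∀ y ∈ S, f y ≤ f x}

/-- The argmax meets the compact set `F` exactly when the maximum over `F` dominates all values on
`S`. By continuity this is tested on countable dense subsets, with slack `1 / (n + 1)` because the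
maximum need not be attained on the dense set. -/
lemma measurableSet_argmaxSet_inter [SecondCountableTopology X] {S : Set X} {f : Ω → X → ℝ}
    (hm : ∀ x ∈ S, Measurable fun ω => f ω x)
    (hc : ∀ ω, ContinuousOn (f ω) S) {F : Set X} (hF : IsCompact F) (hFS : F ⊆ S) :
    MeasurableSet {ω | (argmaxSet S (f ω) ∩ F).Nonempty} := by
  obtain ⟨d, hdc, hdd⟩ := TopologicalSpace.exists_countable_dense F
  obtain ⟨e, hec, hed⟩ := TopologicalSpace.exists_countable_dense S
  have key : {ω | (argmaxSet S (f ω) ∩ F).Nonempty} =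
      {ω | F.Nonempty ∧ ∀ y ∈ e, ∀ n : ℕ, ∃ x ∈ d, f ω y < f ω x + 1 / ((n : ℝ) + 1)} := by
    ext ω
    have hcF : ContinuousOn (f ω) F := (hc ω).mono hFS
    have hcF' : Continuous (F.domRestrict (f ω)) := continuousOn_iff_continuous_domRestrict.1 hcF
    have hcS' : Continuous (S.domRestrict (f ω)) := continuousOn_iff_continuous_domRestrict.1 (hc ω)
    constructor
    · rintro ⟨x, ⟨hxS, hx⟩, hxF⟩
      refine ⟨⟨x, hxF⟩, fun y hy n => ?_⟩
      have hpos : 0 < 1 / ((n : ℝ) + 1) := by positivity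
      have hopen : IsOpen {z : F | f ω y < f ω z + 1 / ((n : ℝ) + 1)} :=
        isOpen_lt continuous_const (hcF'.add continuous_const)
      obtain ⟨z, hz, hzd⟩ := hdd.exists_mem_open hopen
        ⟨⟨x, hxF⟩, by
          have := hx y y.2
          simp only [Set.mem_ofPred_eq]; linarith⟩
      exact ⟨z, hz, hzd⟩
    · rintro ⟨hne, h⟩
      obtain ⟨x, hxF, hx⟩ := hF.exists_isMaxOn hne hcF
      have hall : ∀ y ∈ e, f ω y ≤ f ω x := by
        intro y hy
        refine le_of_forall_pos_lt_add fun ε hε => ?_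
        obtain ⟨n, hn⟩ := exists_nat_one_div_lt hε
        obtain ⟨z, hzd, hz⟩ := h y hy n
        have := hx z.2
        simp only [Set.mem_ofPred_eq] at this
        linarith
      refine ⟨x, ⟨hFS hxF, fun y hy => ?_⟩, hxF⟩
      have hclosed : IsClosed {z : S | f ω z ≤ f ω x} := isClosed_le hcS' continuous_const
      have : closure e ⊆ {z : S | f ω z ≤ f ω x} := closure_minimal hall hclosed
      exact this (hed.closure_eq ▸ Set.mem_univ (⟨y, hy⟩ : S))
  rw [key]
  by_cases hne : F.Nonempty
  · simp only [hne, true_and]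
    have : {ω | ∀ y ∈ e, ∀ n : ℕ, ∃ x ∈ d, f ω y < f ω x + 1 / ((n : ℝ) + 1)} =
        ⋂ y ∈ e, ⋂ n : ℕ, ⋃ x ∈ d, {ω | f ω y < f ω x + 1 / ((n : ℝ) + 1)} := by
      ext ω; simp
    rw [this]
    refine MeasurableSet.biInter hec fun y _ => MeasurableSet.iInter fun n =>
      MeasurableSet.biUnion hdc fun x _ => ?_
    exact measurableSet_lt (hm y y.2) ((hm x (hFS x.2)).add_const _)
  · simp [hne]

/-- Kuratowski–Ryll-Nardzewski selection, for the argmax over a compact set. -/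
lemma exists_measurable_argmax [SecondCountableTopology X] [MeasurableSpace X] [BorelSpace X]
    {S : Set X} (hS : IsCompact S) (hne : S.Nonempty) {f : Ω → X → ℝ}
    (hm : ∀ x ∈ S, Measurable fun ω => f ω x) (hc : ∀ ω, ContinuousOn (f ω) S) :
    ∃ s : Ω → X, Measurable s ∧ ∀ ω, s ω ∈ S ∧ ∀ y ∈ S, f ω y ≤ f ω (s ω) := by
  classical
  have : Nonempty X := ⟨hne.some⟩
  have hxd := TopologicalSpace.denseRange_denseSeq X
  set x := TopologicalSpace.denseSeq X with hx
  let ball : ℕ → ℕ → Set X := fun n i => Metric.closedBall (x i) ((1 / 2) ^ n)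
  have hcover : ∀ n (A : Set X), A.Nonempty → ∃ i, (A ∩ ball n i).Nonempty := by
    rintro n A ⟨a, ha⟩
    obtain ⟨i, hi⟩ := hxd.exists_dist_lt a (show (0 : ℝ) < (1 / 2) ^ n by positivity)
    exact ⟨i, a, ha, hi.le⟩
  -- the nested random compact sets and the indices chosen along the way
  let idx : ℕ → Set X → ℕ := fun n A =>
    if h : ∃ i, (A ∩ ball n i).Nonempty then Nat.find h else 0
  let A : ℕ → Ω → Set X := fun n => Nat.rec (fun ω => argmaxSet S (f ω))
    (fun n B ω => B ω ∩ ball n (idx n (B ω))) n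
  have hA0 : ∀ ω, A 0 ω = argmaxSet S (f ω) := fun ω => rfl
  have hAs : ∀ n ω, A (n + 1) ω = A n ω ∩ ball n (idx n (A n ω)) := fun n ω => rfl
  have hidx : ∀ n (B : Set X), B.Nonempty → (B ∩ ball n (idx n B)).Nonempty := by
    intro n B hB
    have h := hcover n B hB
    simp only [idx, dif_pos h]
    exact Nat.find_spec h
  have hAne : ∀ n ω, (A n ω).Nonempty := by
    intro n ω
    induction n with
    | zero =>
      obtain ⟨z, hz, hz'⟩ := hS.exists_isMaxOn hne (hc ω)
      exact ⟨z, hz, fun y hy => hz' hy⟩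
    | succ n ih => rw [hAs]; exact hidx n _ ih
  have hAmono : ∀ n ω, A n ω ⊆ argmaxSet S (f ω) := by
    intro n ω
    induction n with
    | zero => exact subset_rfl
    | succ n ih => rw [hAs]; exact Set.inter_subset_left.trans ih
  have hidx_eq : ∀ n ω i, idx n (A n ω) = i ↔
      (A n ω ∩ ball n i).Nonempty ∧ ∀ j < i, ¬ (A n ω ∩ ball n j).Nonempty := by
    intro n ω i
    have h := hcover n _ (hAne n ω)
    simp only [idx, dif_pos h]
    exact Nat.find_eq_iff h
  have hAmeas : ∀ n, ∀ F : Set X, IsClosed F →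
      MeasurableSet {ω | (A n ω ∩ F).Nonempty} := by
    intro n
    induction n with
    | zero =>
      intro F hF
      have hcomp : IsCompact (S ∩ F) := hS.inter_right hF
      have e : {ω | (A 0 ω ∩ F).Nonempty} = {ω | (argmaxSet S (f ω) ∩ (S ∩ F)).Nonempty} := by
        ext ω
        simp only [hA0, Set.mem_ofPred_eq]
        constructor
        · rintro ⟨z, hz, hzF⟩; exact ⟨z, hz, hz.1, hzF⟩
        · rintro ⟨z, hz, _, hzF⟩; exact ⟨z, hz, hzF⟩
      rw [e]
      exact measurableSet_argmaxSet_inter hm hc hcomp Set.inter_subset_left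
    | succ n ih =>
      intro F hF
      -- The event is split according to the least index of a ball that meets `A n ω`; on each piece
      -- the ball is no longer random and the induction hypothesis applies to closed sets.
      have e : {ω | (A (n + 1) ω ∩ F).Nonempty} = ⋃ i, ({ω | (A n ω ∩ ball n i).Nonempty} ∩
          (⋂ j ∈ Finset.range i, {ω | (A n ω ∩ ball n j).Nonempty}ᶜ) ∩
          {ω | (A n ω ∩ (ball n i ∩ F)).Nonempty}) := by
        ext ω
        simp only [hAs, Set.mem_ofPred_eq, Set.mem_iUnion, Set.mem_inter_iff, Set.mem_iInter,
          Finset.mem_range, Set.mem_compl_iff]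
        constructor
        · intro h
          refine ⟨idx n (A n ω), (hidx_eq n ω _).1 rfl, ?_⟩
          rwa [← Set.inter_assoc]
        · rintro ⟨i, hi, h⟩
          rw [(hidx_eq n ω i).2 hi, Set.inter_assoc]
          exact h
      rw [e]
      refine MeasurableSet.iUnion fun i => ((ih _ Metric.isClosed_closedBall).inter
        (Finset.measurableSet_biInter _ fun j _ => (ih _ Metric.isClosed_closedBall).compl)).inter
        (ih _ (Metric.isClosed_closedBall.inter hF))
  have hidx_meas : ∀ n, Measurable fun ω => idx n (A n ω) := by
    intro n
    refine measurable_to_countable' fun i => ?_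
    have e : (fun ω => idx n (A n ω)) ⁻¹' {i} = {ω | (A n ω ∩ ball n i).Nonempty} ∩
        (⋂ j ∈ Finset.range i, {ω | (A n ω ∩ ball n j).Nonempty}ᶜ) := by
      ext ω
      simp only [Set.mem_preimage, Set.mem_singleton_iff, hidx_eq, Set.mem_inter_iff,
        Set.mem_ofPred_eq, Set.mem_iInter, Finset.mem_range, Set.mem_compl_iff]
    rw [e]
    exact (hAmeas n _ Metric.isClosed_closedBall).inter
      (Finset.measurableSet_biInter _ fun j _ => (hAmeas n _ Metric.isClosed_closedBall).compl)
  -- a point of all the nested sets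
  have hargc : ∀ ω, IsCompact (argmaxSet S (f ω)) := by
    intro ω
    obtain ⟨z, hz, hz'⟩ := hS.exists_isMaxOn hne (hc ω)
    have e : argmaxSet S (f ω) = S ∩ f ω ⁻¹' Set.Ici (f ω z) := by
      ext y
      constructor
      · rintro ⟨hy, hy'⟩; exact ⟨hy, hy' z hz⟩
      · rintro ⟨hy, hy'⟩; exact ⟨hy, fun w hw => (hz' hw).trans hy'⟩
    rw [e]
    exact hS.of_isClosed_subset ((hc ω).preimage_isClosed_of_isClosed hS.isClosed isClosed_Ici)
      Set.inter_subset_left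
  have hAc : ∀ n ω, IsCompact (A n ω) := by
    intro n ω
    induction n with
    | zero => exact hargc ω
    | succ n ih => rw [hAs]; exact ih.inter_right Metric.isClosed_closedBall
  have hlim : ∀ ω, (⋂ n, A n ω).Nonempty := fun ω =>
    IsCompact.nonempty_iInter_of_sequence_nonempty_isCompact_isClosed (fun n => A n ω)
      (fun n => by rw [hAs]; exact Set.inter_subset_left) (fun n => hAne n ω) (hAc 0 ω)
      (fun n => (hAc n ω).isClosed)
  choose s hs using hlim
  refine ⟨s, ?_, fun ω => ?_⟩
  -- The chosen centres are measurable functions of `ω` with countably many values, and they lie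
  -- within `2⁻ⁿ` of `s ω`.
  · refine measurable_of_tendsto_metrizable (f := fun n ω => x (idx n (A n ω)))
      (fun n => (measurable_from_top (f := x)).comp (hidx_meas n)) ?_
    rw [tendsto_pi_nhds]
    intro ω
    rw [tendsto_iff_dist_tendsto_zero]
    refine squeeze_zero (fun _ => dist_nonneg) (fun n => ?_)
      (tendsto_pow_atTop_nhds_zero_of_lt_one (by norm_num : (0 : ℝ) ≤ 1 / 2) (by norm_num))
    have := Set.mem_iInter.1 (hs ω) (n + 1)
    rw [hAs] at this
    rw [dist_comm]
    exact this.2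
  · exact hAmono 0 ω (Set.mem_iInter.1 (hs ω) 0)

end MeasurableArgmax

/-! ### The empirical process over one shell. -/

section

variable {p q : ℕ} {M : Model p q} {lam : ℝ} {θl : E q} {r : ℝ} {G : E p → ℝ}

/-- The contribution `K_h(Y - m(W(lam), θ))` of one observation. -/
noncomputable def kern (M : Model p q) (lam h : ℝ) (θ : E q) (z : (E p × ℝ) × E p × E p) : ℝ :=
  Kh h (Yv M z - M.m (Wv lam z) θ)

lemma measurable_kern (h1 : C1 M) (lam h : ℝ) {θ : E q} (hθ : θ ∈ M.Θ) :
    Measurable (kern M lam h θ) := by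
  have hm := measurable_regression h1 hθ
  have hW := measurable_Wv (p := p) lam
  have hY := measurable_Yv h1
  exact (measurable_Kh h).comp (by fun_prop : Measurable fun z => Yv M z - M.m (Wv lam z) θ)

lemma integrable_kern (h1 : C1 M) (lam : ℝ) {h : ℝ} (hh : 0 < h) {θ : E q} (hθ : θ ∈ M.Θ) :
    Integrable (kern M lam h θ) M.popLaw := by
  refine Integrable.of_bound (measurable_kern h1 lam h hθ).aestronglyMeasurable h⁻¹
    (Eventually.of_forall fun z => ?_)
  rw [kern, Real.norm_of_nonneg (Kh_nonneg hh _)]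
  exact Kh_le hh _

lemma GoodBall.sqrt_le (hB : GoodBall M lam θl r G) (w : E p) : Real.sqrt (G w) ≤ 1 + G w := by
  rw [Real.sqrt_le_left (by linarith [hB.nonneg w])]
  nlinarith [hB.nonneg w]

lemma GoodBall.abs_kern_sub_le (hB : GoodBall M lam θl r G) (h1 : C1 M) {h : ℝ} (hh : 0 < h)
    {θ θ' : E q} (hθ : θ ∈ Metric.ball θl r) (hθ' : θ' ∈ Metric.ball θl r)
    (z : (E p × ℝ) × E p × E p) :
    |kern M lam h θ z - kern M lam h θ' z| ≤ (h ^ 2)⁻¹ * ‖θ - θ'‖ * (1 + G (Wv lam z)) := by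
  refine (abs_Kh_sub_Kh_le hh _ _).trans ?_
  rw [mul_assoc]
  refine mul_le_mul_of_nonneg_left ?_ (by positivity)
  have e : Yv M z - M.m (Wv lam z) θ - (Yv M z - M.m (Wv lam z) θ') =
      -(M.m (Wv lam z) θ - M.m (Wv lam z) θ') := by ring
  rw [e, abs_neg, mul_comm]
  exact (hB.abs_sub_le h1 _ hθ hθ').trans
    (mul_le_mul_of_nonneg_right (hB.sqrt_le _) (norm_nonneg _))

/-- Given `W(lam)`, the response density is at most `C`, so the `L²` translation bound applies. It
costs `h⁻³`, where squaring the pointwise Lipschitz bound would cost `h⁻⁴`; this is the source of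
`(n h³)^(-1/2)`. -/
lemma GoodBall.integral_sq_kern_sub_le (hB : GoodBall M lam θl r G) (h1 : C1 M) {C : ℝ}
    (hC0 : 0 ≤ C) (hC : RegularDens M lam C) {h : ℝ} (hh : 0 < h) {θ θ' : E q}
    (hθ : θ ∈ Metric.ball θl r) (hθ' : θ' ∈ Metric.ball θl r) :
    ∫ z, (kern M lam h θ z - kern M lam h θ' z) ^ 2 ∂M.popLaw ≤
      C * ((h ^ 3)⁻¹ * ‖θ - θ'‖ ^ 2) * ∫ z, G (Wv lam z) ∂M.popLaw := by
  have hm := measurable_regression h1 (hB.mem hθ)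
  have hm' := measurable_regression h1 (hB.mem hθ')
  have hK := measurable_Kh h
  have hI0 : 0 ≤ ∫ z, G (Wv lam z) ∂M.popLaw := integral_nonneg fun z => hB.nonneg _
  rw [integral_eq_lintegral_of_nonneg_ae
    (f := fun z => (kern M lam h θ z - kern M lam h θ' z) ^ 2)
    (Eventually.of_forall fun _ => sq_nonneg _) (((measurable_kern h1 lam h (hB.mem hθ)).sub
      (measurable_kern h1 lam h (hB.mem hθ'))).pow_const 2).aestronglyMeasurable]
  refine ENNReal.toReal_le_of_le_ofReal (by positivity) ?_
  have hφ : Measurable (Function.uncurry fun (w : E p) s =>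
      ENNReal.ofReal ((Kh h (s - M.m w θ) - Kh h (s - M.m w θ')) ^ 2)) := by
    refine Measurable.ennreal_ofReal (Measurable.pow_const (Measurable.sub ?_ ?_) 2)
    · exact hK.comp (by fun_prop : Measurable fun a : E p × ℝ => a.2 - M.m a.1 θ)
    · exact hK.comp (by fun_prop : Measurable fun a : E p × ℝ => a.2 - M.m a.1 θ')
  have e := lintegral_resp h1 hC hφ
  refine (le_of_eq e).trans ?_
  have hdens : ∀ᵐ z ∂M.popLaw, ∀ s, respDens M lam (Wv lam z) s ≤ C := by
    filter_upwards [hC] with z hz s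
    have := hz.2.2 0 (by norm_num) s
    rw [iteratedDeriv_zero] at this
    exact (le_abs_self _).trans this
  calc _ ≤ ∫⁻ z, ENNReal.ofReal (C * ((h ^ 3)⁻¹ * ‖θ - θ'‖ ^ 2)) * ENNReal.ofReal (G (Wv lam z))
        ∂M.popLaw := by
        refine lintegral_mono_ae ?_
        filter_upwards [hdens] with z hz
        calc _ ≤ ∫⁻ s, ENNReal.ofReal ((Kh h (s - M.m (Wv lam z) θ) -
              Kh h (s - M.m (Wv lam z) θ')) ^ 2) * ENNReal.ofReal C :=
              lintegral_mono fun s => mul_le_mul_right (ENNReal.ofReal_le_ofReal (hz s)) _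
          _ = (∫⁻ s, ENNReal.ofReal ((Kh h (s - M.m (Wv lam z) θ) -
              Kh h (s - M.m (Wv lam z) θ')) ^ 2)) * ENNReal.ofReal C :=
              lintegral_mul_const' _ _ ENNReal.ofReal_ne_top
          _ ≤ ENNReal.ofReal ((h ^ 3)⁻¹ * (M.m (Wv lam z) θ - M.m (Wv lam z) θ') ^ 2) *
              ENNReal.ofReal C := mul_le_mul_left (lintegral_sq_Kh_sub_le hh _ _) _
          _ ≤ _ := by
              rw [← ENNReal.ofReal_mul (by positivity), ← ENNReal.ofReal_mul (by positivity)]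
              refine ENNReal.ofReal_le_ofReal ?_
              have h2 : (M.m (Wv lam z) θ - M.m (Wv lam z) θ') ^ 2 ≤
                  G (Wv lam z) * ‖θ - θ'‖ ^ 2 := by
                rw [← sq_abs, ← Real.sq_sqrt (hB.nonneg (Wv lam z)), ← mul_pow]
                exact pow_le_pow_left₀ (abs_nonneg _) (hB.abs_sub_le h1 _ hθ hθ') 2
              have h3 : 0 ≤ (h ^ 3)⁻¹ * C := by positivity
              nlinarith [mul_le_mul_of_nonneg_left h2 h3]
    _ = _ := by
        rw [lintegral_const_mul' _ _ ENNReal.ofReal_ne_top,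
          ← ofReal_integral_eq_lintegral_ofReal hB.integrable
            (Eventually.of_forall fun z => hB.nonneg _), ← ENNReal.ofReal_mul (by positivity)]

section Empirical

variable {Ω : Type*} {ζ : ℕ → Ω → (E p × ℝ) × E p × E p}

/-- The empirical objective formed with the first `n` observations of `ζ`. -/
noncomputable def empObj (M : Model p q) (lam h : ℝ) (ζ : ℕ → Ω → (E p × ℝ) × E p × E p) (n : ℕ)
    (ω : Ω) (θ : E q) : ℝ := (n : ℝ)⁻¹ * ∑ i ∈ Finset.range n, kern M lam h θ (ζ i ω)

/-- The centered empirical objective. -/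
noncomputable def empDev (M : Model p q) (lam h : ℝ) (ζ : ℕ → Ω → (E p × ℝ) × E p × E p) (n : ℕ)
    (ω : Ω) (θ : E q) : ℝ := empObj M lam h ζ n ω θ - popObj M lam h θ

lemma empDev_sub (h1 : C1 M) {h : ℝ} (hh : 0 < h) {n : ℕ} (hn : 0 < n) {θ θ' : E q}
    (hθ : θ ∈ M.Θ) (hθ' : θ' ∈ M.Θ) (ω : Ω) :
    empDev M lam h ζ n ω θ - empDev M lam h ζ n ω θ' =
      (n : ℝ)⁻¹ * ∑ i ∈ Finset.range n, ((kern M lam h θ (ζ i ω) - kern M lam h θ' (ζ i ω)) -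
        ∫ z, (kern M lam h θ z - kern M lam h θ' z) ∂M.popLaw) := by
  have hn' : (n : ℝ) ≠ 0 := by positivity
  rw [integral_sub (integrable_kern h1 lam hh hθ) (integrable_kern h1 lam hh hθ')]
  simp only [empDev, empObj, popObj, Finset.sum_sub_distrib, Finset.sum_const, Finset.card_range,
    nsmul_eq_mul]
  change _ - ∫ z, kern M lam h θ z ∂M.popLaw - (_ - ∫ z, kern M lam h θ' z ∂M.popLaw) = _
  field_simp
  ring

/-- The average of `1 + G(W(lam))`. -/
noncomputable def avgDom (lam : ℝ) (G : E p → ℝ) (ζ : ℕ → Ω → (E p × ℝ) × E p × E p) (n : ℕ)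
    (ω : Ω) : ℝ := (n : ℝ)⁻¹ * ∑ i ∈ Finset.range n, (1 + G (Wv lam (ζ i ω)))

/-- A crude pathwise bound, with the large constant `h⁻²`, used only below the last chaining scale.
-/
lemma GoodBall.abs_empDev_sub_le (hB : GoodBall M lam θl r G) (h1 : C1 M) {h : ℝ} (hh : 0 < h)
    {n : ℕ} (hn : 0 < n) {θ θ' : E q} (hθ : θ ∈ Metric.ball θl r) (hθ' : θ' ∈ Metric.ball θl r)
    (ω : Ω) :
    |empDev M lam h ζ n ω θ - empDev M lam h ζ n ω θ'| ≤ (h ^ 2)⁻¹ * ‖θ - θ'‖ *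
      (avgDom lam G ζ n ω + ∫ z, (1 + G (Wv lam z)) ∂M.popLaw) := by
  have hn' : (n : ℝ) ≠ 0 := by positivity
  set I := ∫ z, (1 + G (Wv lam z)) ∂M.popLaw with hI
  set c := (h ^ 2)⁻¹ * ‖θ - θ'‖ with hc
  have hint : |∫ z, (kern M lam h θ z - kern M lam h θ' z) ∂M.popLaw| ≤ c * I := by
    rw [← Real.norm_eq_abs, hI, ← integral_const_mul]
    exact norm_integral_le_of_norm_le (((integrable_const 1).add hB.integrable).const_mul _)
      (Eventually.of_forall fun z => hB.abs_kern_sub_le h1 hh hθ hθ' z)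
  rw [empDev_sub h1 hh hn (hB.mem hθ) (hB.mem hθ'), abs_mul, abs_of_nonneg (by positivity)]
  calc (n : ℝ)⁻¹ * |∑ i ∈ Finset.range n, ((kern M lam h θ (ζ i ω) - kern M lam h θ' (ζ i ω)) -
        ∫ z, (kern M lam h θ z - kern M lam h θ' z) ∂M.popLaw)|
      ≤ (n : ℝ)⁻¹ * ∑ i ∈ Finset.range n, (c * (1 + G (Wv lam (ζ i ω))) + c * I) := by
        refine mul_le_mul_of_nonneg_left ((Finset.abs_sum_le_sum_abs _ _).trans
          (Finset.sum_le_sum fun i _ => (abs_sub _ _).trans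
            (add_le_add (hB.abs_kern_sub_le h1 hh hθ hθ' _) hint))) (by positivity)
    _ = _ := by
        rw [Finset.sum_add_distrib, ← Finset.mul_sum, Finset.sum_const, Finset.card_range,
          nsmul_eq_mul, avgDom]
        field_simp

variable [MeasurableSpace Ω] {P : Measure Ω} [IsProbabilityMeasure P]

lemma GoodBall.measure_empDev_sub_gt_le (hB : GoodBall M lam θl r G) (h1 : C1 M) {C : ℝ}
    (hC0 : 0 ≤ C) (hC : RegularDens M lam C) (hζ : IsIID P M.popLaw ζ) {h : ℝ} (hh : 0 < h)
    {n : ℕ} (hn : 0 < n) {θ θ' : E q} (hθ : θ ∈ Metric.ball θl r) (hθ' : θ' ∈ Metric.ball θl r)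
    {l : ℝ} (hl : 0 ≤ l) (hl1 : 2 * h⁻¹ * l ≤ 1) (x : ℝ) :
    P {ω | x < |empDev M lam h ζ n ω θ - empDev M lam h ζ n ω θ'|} ≤
      ENNReal.ofReal (2 * Real.exp (-l * (n * x) + n * l ^ 2 *
        (C * ((h ^ 3)⁻¹ * ‖θ - θ'‖ ^ 2) * ∫ z, G (Wv lam z) ∂M.popLaw))) := by
  have hn' : (0 : ℝ) < n := by positivity
  refine le_trans (measure_mono ?_) (hζ.bernstein (A := h⁻¹)
    ((measurable_kern h1 lam h (hB.mem hθ)).sub (measurable_kern h1 lam h (hB.mem hθ')))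
    (fun z => abs_Kh_sub_Kh_le_inv hh _ _) (hB.integral_sq_kern_sub_le h1 hC0 hC hh hθ hθ')
    hl hl1 n (n * x))
  intro ω hω
  simp only [Set.mem_ofPred_eq] at hω
  rw [empDev_sub h1 hh hn (hB.mem hθ) (hB.mem hθ'), abs_mul, abs_of_pos (inv_pos.2 hn'),
    lt_inv_mul_iff₀ hn'] at hω
  exact hω

/-- Control of the empirical process over one shell. -/
lemma GoodBall.exists_shell_const (hB : GoodBall M lam θl r G) (h1 : C1 M) {C : ℝ}
    (hC0 : 0 ≤ C) (hC : RegularDens M lam C) (hζ : IsIID P M.popLaw ζ) :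
    ∃ C₂ > 0, ∀ (h : ℝ) (n : ℕ) (a s t l : ℝ) (θ : E q), 0 < h → h ≤ 1 → 0 < n → 0 < a →
      h ^ 2 ≤ a → 1 ≤ n * h ^ 3 * a ^ 2 → a ≤ s → 1 ≤ t →
      (∀ u : E q, ‖u‖ ≤ 1 → θ + s • u ∈ Metric.ball θl r) →
      P {ω | avgDom lam G ζ n ω ≤ l ∧ ∃ u : E q, ‖u‖ ≤ 1 ∧
        (2 * t + 16 * (l + ∫ z, (1 + G (Wv lam z)) ∂M.popLaw)) * (s * a) <
          |empDev M lam h ζ n ω (θ + s • u) - empDev M lam h ζ n ω θ|} ≤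
        ENNReal.ofReal (C₂ / t) := by
  obtain ⟨C₁, hC₁, hchain⟩ := exists_chaining_const q
  set J := ∫ z, G (Wv lam z) ∂M.popLaw with hJ
  set I := ∫ z, (1 + G (Wv lam z)) ∂M.popLaw with hI
  have hJ0 : 0 ≤ J := integral_nonneg fun z => hB.nonneg _
  have hI0 : 0 ≤ I := integral_nonneg fun z => by
    simp only [Pi.zero_apply]; linarith [hB.nonneg (Wv lam z)]
  refine ⟨C₁ * (2 * Real.exp (4 * C * J)), by positivity, ?_⟩
  intro h n a s t l θ hh hh1 hn ha hha hna has ht hball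
  have hs : 0 < s := ha.trans_le has
  have hn' : (0 : ℝ) < n := by positivity
  -- `K` is the last level with `16 ^ K ≤ h⁻⁴`. At distance `16⁻ᴷ ≤ 16 h⁴` the Lipschitz bound
  -- leaves a multiple of `h⁻² s h⁴ = s h² ≤ s a`.
  obtain ⟨K, hK1, hK2⟩ := exists_nat_pow_near (x := (h ^ 4)⁻¹) (y := 16)
    ((one_le_inv₀ (by positivity)).2 (pow_le_one₀ hh.le hh1)) (by norm_num)
  refine le_trans (measure_mono ?_) (hchain P (fun ω u => empDev M lam h ζ n ω (θ + s • u)) K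
    (s * a * t) t (2 * Real.exp (4 * C * J)) (16 * (l + I) * (s * a))
    (by positivity) ht (by positivity) ?_)
  · rintro ω ⟨hω, u, hu, hbig⟩
    have havg : 0 ≤ avgDom lam G ζ n ω :=
      mul_nonneg (by positivity) (Finset.sum_nonneg fun i _ => by
        linarith [hB.nonneg (Wv lam (ζ i ω))])
    have hl0 : 0 ≤ l + I := add_nonneg (havg.trans hω) hI0
    refine ⟨fun u v hu hv huv => ?_, u, hu, ?_⟩
    · refine (hB.abs_empDev_sub_le h1 hh hn (hball u hu) (hball v hv) ω).trans ?_
      have e : θ + s • u - (θ + s • v) = s • (u - v) := by rw [smul_sub]; abel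
      rw [e, norm_smul, Real.norm_of_nonneg hs.le]
      have h16 : ((16 : ℝ) ^ K)⁻¹ ≤ 16 * h ^ 4 := by
        rw [inv_le_comm₀ (by positivity) (by positivity), mul_inv]
        rw [pow_succ (16 : ℝ)] at hK2
        linarith
      calc (h ^ 2)⁻¹ * (s * ‖u - v‖) * (avgDom lam G ζ n ω + I)
          ≤ (h ^ 2)⁻¹ * (s * (16 * h ^ 4)) * (l + I) := by
            have := huv.trans h16
            have : 0 ≤ avgDom lam G ζ n ω + I := add_nonneg havg hI0
            gcongr
        _ = 16 * (l + I) * (s * h ^ 2) := by field_simp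
        _ ≤ 16 * (l + I) * (s * a) := by gcongr
    · simp only [smul_zero, add_zero]
      refine lt_of_eq_of_lt ?_ hbig
      ring
  · intro k hk u v hu hv huv
    -- The Bernstein parameter at level `k` is `4 ^ k / (n s a)`. Against the threshold `s a t 2⁻ᵏ`
    -- its linear term is exactly `-(2 ^ k t)`; the quadratic term is at most `4 C J`, since the
    -- squared distance `4 · 16⁻²ᵏ` outweighs the `16 ^ k` in the squared parameter.
    have hl0 : (0 : ℝ) ≤ 4 ^ k / (n * s * a) := by positivity
    -- Since `k < K`, `4 ^ (k + 1) ≤ h⁻²`; together with `n s a ≥ h⁻³` this makes the parameter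
    -- admissible for summands of size `h⁻¹`.
    have h4 : (4 : ℝ) ^ (k + 1) ≤ (h ^ 2)⁻¹ := by
      refine le_of_sq_le_sq ?_ (by positivity)
      calc ((4 : ℝ) ^ (k + 1)) ^ 2 = 16 ^ (k + 1) := by rw [← pow_mul, mul_comm, pow_mul]; norm_num
        _ ≤ 16 ^ K := pow_le_pow_right₀ (by norm_num) hk
        _ ≤ (h ^ 4)⁻¹ := hK1
        _ = ((h ^ 2)⁻¹) ^ 2 := by rw [inv_pow, ← pow_mul]
    have hnsa : (h ^ 3)⁻¹ ≤ n * s * a := by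
      rw [inv_le_iff_one_le_mul₀ (by positivity)]
      calc 1 ≤ n * h ^ 3 * a ^ 2 := hna
        _ = (n * a * a) * h ^ 3 := by ring
        _ ≤ (n * s * a) * h ^ 3 := by gcongr
    have hl1 : 2 * h⁻¹ * (4 ^ k / (n * s * a)) ≤ 1 := by
      rw [← mul_div_assoc, div_le_one (by positivity)]
      refine le_trans ?_ hnsa
      rw [pow_succ] at h4
      have h5 : (2 : ℝ) * 4 ^ k ≤ (h ^ 2)⁻¹ := by
        have : (0 : ℝ) < 4 ^ k := by positivity
        linarith
      calc 2 * h⁻¹ * 4 ^ k = h⁻¹ * (2 * 4 ^ k) := by ring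
        _ ≤ h⁻¹ * (h ^ 2)⁻¹ := by gcongr
        _ = (h ^ 3)⁻¹ := by rw [← mul_inv]; ring_nf
    refine (hB.measure_empDev_sub_gt_le h1 hC0 hC hζ hh hn (hball u hu) (hball v hv) hl0 hl1
      _).trans (ENNReal.ofReal_le_ofReal ?_)
    have e : θ + s • u - (θ + s • v) = s • (u - v) := by rw [smul_sub]; abel
    rw [e, norm_smul, Real.norm_of_nonneg hs.le, mul_assoc 2 (Real.exp _), ← Real.exp_add]
    refine mul_le_mul_of_nonneg_left (Real.exp_le_exp.2 ?_) (by norm_num)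
    have e1 : -(4 ^ k / (n * s * a)) * (n * (s * a * t * (1 / 2) ^ k)) = -(2 ^ k * t) := by
      have : (4 : ℝ) ^ k = 2 ^ k * 2 ^ k := by rw [← mul_pow]; norm_num
      rw [this, one_div, inv_pow]
      field_simp
    have e2 : n * (4 ^ k / (n * s * a)) ^ 2 * (C * ((h ^ 3)⁻¹ * (s * ‖u - v‖) ^ 2) * J) ≤
        4 * C * J := by
      calc n * (4 ^ k / (n * s * a)) ^ 2 * (C * ((h ^ 3)⁻¹ * (s * ‖u - v‖) ^ 2) * J)
          ≤ n * (4 ^ k / (n * s * a)) ^ 2 *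
              (C * ((h ^ 3)⁻¹ * (s * (2 * ((16 : ℝ) ^ k)⁻¹)) ^ 2) * J) := by gcongr
        _ = (4 * C * J) * ((1 / (n * h ^ 3 * a ^ 2)) * ((16 : ℝ) ^ k)⁻¹) := by
            have : (4 ^ k / (n * s * a) : ℝ) ^ 2 = 16 ^ k / (n * s * a) ^ 2 := by
              rw [div_pow, ← pow_mul, mul_comm k, pow_mul]; norm_num
            rw [this]
            field_simp
            ring
        _ ≤ (4 * C * J) * (1 * 1) := by
            have h6 : 1 / (n * h ^ 3 * a ^ 2) ≤ 1 := by
              rw [div_le_one (by positivity)]; exact hna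
            have h7 : ((16 : ℝ) ^ k)⁻¹ ≤ 1 :=
              inv_le_one_of_one_le₀ (one_le_pow₀ (by norm_num))
            gcongr
        _ = 4 * C * J := by ring
    rw [e1]
    linarith

end Empirical

end

/-! ### Peeling, the averaged estimator and the local maximizer. -/

section

variable {p q : ℕ} {M : Model p q} {lam : ℝ} {θl : E q} {r : ℝ} {G : E p → ℝ}

section Rate

variable {Ω : Type*} [MeasurableSpace Ω] {P : Measure Ω} [IsProbabilityMeasure P]
  {ζ : ℕ → Ω → (E p × ℝ) × E p × E p}

/-- Peeling: points at which the empirical objective beats its value at `θ'` are close to `θ'`. -/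
lemma GoodBall.exists_rate (hB : GoodBall M lam θl r G) (h1 : C1 M) {C : ℝ}
    (hC0 : 0 ≤ C) (hC : RegularDens M lam C) (hζ : IsIID P M.popLaw ζ) {c : ℝ} (hc : 0 < c)
    {ρ : ℝ} (hρ : 5 * ρ < r) {η : ℝ} (hη : 0 < η) :
    ∃ D : ℝ, ∀ (h : ℝ) (n : ℕ) (a : ℝ) (θ' : E q), 0 < h → h ≤ 1 → 0 < n → 0 < a →
      h ^ 2 ≤ a → 1 ≤ n * h ^ 3 * a ^ 2 → θ' ∈ Metric.closedBall θl ρ →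
      (∀ θ ∈ Metric.closedBall θl ρ,
        popObj M lam h θ ≤ popObj M lam h θ' - c * ‖θ - θ'‖ ^ 2) →
      P {ω | ∃ θ ∈ Metric.closedBall θl ρ, D * a < ‖θ - θ'‖ ∧
        empObj M lam h ζ n ω θ' ≤ empObj M lam h ζ n ω θ} ≤ ENNReal.ofReal η := by
  obtain ⟨C₂, hC₂, hshell⟩ := hB.exists_shell_const h1 hC0 hC hζ
  set I := ∫ z, (1 + G (Wv lam z)) ∂M.popLaw with hI
  have hGi : Integrable (fun z => 1 + G (Wv lam z)) M.popLaw :=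
    (integrable_const 1).add hB.integrable
  have hI0 : 0 ≤ I := integral_nonneg fun z => by
    simp only [Pi.zero_apply]; linarith [hB.nonneg (Wv lam z)]
  -- At this level Markov's inequality leaves at most `η / 2` for a large average of the dominating
  -- function.
  set l := 2 * (I + 1) / η with hl
  have hl0 : 0 < l := by positivity
  -- In order, `D` must make the radii at least `a`, the tail parameters `t j` at least one, the
  -- Lipschitz remainder less than half of the drop, and the summed shell probabilities at most `η /
  -- 2`.
  obtain ⟨D, hD⟩ : ∃ D : ℝ, 1 ≤ D ∧ 1 ≤ c * D / 8 ∧ 16 * (l + I) < c * D / 4 ∧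
      16 * C₂ / (c * D) ≤ η / 2 := by
    have ht : Tendsto (fun D : ℝ => c * D) atTop atTop := tendsto_id.const_mul_atTop hc
    have := (((eventually_ge_atTop (1 : ℝ)).and (ht.eventually_ge_atTop 8)).and
      ((ht.eventually_gt_atTop (64 * (l + I))).and
        (ht.eventually_ge_atTop (32 * C₂ / η)))).exists
    obtain ⟨D, ⟨hD1, hD2⟩, hD3, hD4⟩ := this
    refine ⟨D, hD1, by linarith, by linarith, ?_⟩
    rw [div_le_iff₀ (by positivity)]
    rw [div_le_iff₀ hη] at hD4
    linarith
  obtain ⟨hD1, hD2, hD3, hD4⟩ := hD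
  have hD0 : 0 < D := by linarith
  refine ⟨D, ?_⟩
  intro h n a θ' hh hh1 hn ha hha hna hθ' hdrop
  let s : ℕ → ℝ := fun j => 2 ^ (j + 1) * (D * a)
  -- Divided by `s j * a`, the drop on shell `j` is at least `c 2 ^ j D / 2`. Half of it is `2 * t
  -- j`; the other half exceeds the remainder `16 (l + I)`.
  let t : ℕ → ℝ := fun j => c * 2 ^ j * D / 8
  have ht : ∀ j, t j = 2 ^ j * (c * D / 8) := fun j => by simp only [t]; ring
  -- A shell that contains a point of the ball has `s j ≤ 2 ‖θ - θ'‖ ≤ 4ρ`; a ball of that radius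
  -- around `θ'` lies within `5ρ < r` of `θl`.
  let bad : ℕ → Set Ω := fun j => {ω | s j ≤ 4 * ρ ∧ avgDom lam G ζ n ω ≤ l ∧
    ∃ u : E q, ‖u‖ ≤ 1 ∧ (2 * t j + 16 * (l + I)) * (s j * a) <
      |empDev M lam h ζ n ω (θ' + s j • u) - empDev M lam h ζ n ω θ'|}
  have hspos : ∀ j, 0 < s j := fun j => by positivity
  have hbad : ∀ j, P (bad j) ≤ ENNReal.ofReal (8 * C₂ / (c * D) * (1 / 2) ^ j) := by
    intro j
    by_cases hj : s j ≤ 4 * ρ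
    · have h2j : (1 : ℝ) ≤ 2 ^ j := one_le_pow₀ (by norm_num)
      have has : a ≤ s j := by
        simp only [s]
        have h2 : (1 : ℝ) ≤ 2 ^ (j + 1) := one_le_pow₀ (by norm_num)
        calc a = 1 * (1 * a) := by ring
          _ ≤ 2 ^ (j + 1) * (D * a) := by gcongr
      have ht1 : 1 ≤ t j := by
        rw [ht]
        calc (1 : ℝ) = 1 * 1 := by ring
          _ ≤ 2 ^ j * (c * D / 8) := by gcongr
      refine (measure_mono ?_).trans ((hshell h n a (s j) (t j) l θ' hh hh1 hn ha hha hna has ht1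
        fun u hu => ?_).trans (ENNReal.ofReal_le_ofReal ?_))
      · exact fun ω hω => hω.2
      · rw [mem_ball_iff_norm]
        rw [mem_closedBall_iff_norm] at hθ'
        have e : θ' + s j • u - θl = (θ' - θl) + s j • u := by abel
        rw [e]
        refine (norm_add_le _ _).trans_lt ?_
        rw [norm_smul, Real.norm_of_nonneg (hspos j).le]
        have := mul_le_mul_of_nonneg_left hu (hspos j).le
        linarith
      · refine le_of_eq ?_
        simp only [t, one_div, inv_pow]
        field_simp
    · have : bad j = ∅ := by
        ext ω; simp [bad, hj]
      simp [this]
  have hsub : {ω | ∃ θ ∈ Metric.closedBall θl ρ, D * a < ‖θ - θ'‖ ∧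
      empObj M lam h ζ n ω θ' ≤ empObj M lam h ζ n ω θ} ⊆
      {ω | l < avgDom lam G ζ n ω} ∪ ⋃ j, bad j := by
    rintro ω ⟨θ, hθ, hfar, hemp⟩
    by_cases havg : l < avgDom lam G ζ n ω
    · exact Or.inl havg
    refine Or.inr (Set.mem_iUnion.2 ?_)
    have hDa : 0 < D * a := by positivity
    obtain ⟨j, hj1, hj2⟩ := exists_nat_pow_near (x := ‖θ - θ'‖ / (D * a)) (y := 2)
      ((one_le_div hDa).2 hfar.le) (by norm_num)
    rw [le_div_iff₀ hDa] at hj1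
    rw [div_lt_iff₀ hDa] at hj2
    have hs2 : s j = 2 * (2 ^ j * (D * a)) := by simp only [s]; ring
    refine ⟨j, ?_, not_lt.1 havg, (s j)⁻¹ • (θ - θ'), ?_, ?_⟩
    · rw [mem_closedBall_iff_norm] at hθ hθ'
      have : ‖θ - θ'‖ ≤ 2 * ρ := by
        have e : θ - θ' = (θ - θl) - (θ' - θl) := by abel
        rw [e]
        exact (norm_sub_le _ _).trans (by linarith)
      linarith
    · rw [norm_smul, norm_inv, Real.norm_of_nonneg (hspos j).le, inv_mul_le_iff₀ (hspos j), mul_one]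
      exact hj2.le
    · rw [smul_inv_smul₀ (hspos j).ne', add_sub_cancel]
      refine lt_of_lt_of_le ?_ (le_abs_self _)
      have hd := hdrop θ hθ
      have h2j : (1 : ℝ) ≤ 2 ^ j := one_le_pow₀ (by norm_num)
      have hge : c * (s j / 2) ^ 2 ≤ empDev M lam h ζ n ω θ - empDev M lam h ζ n ω θ' := by
        have hsq : (s j / 2) ^ 2 ≤ ‖θ - θ'‖ ^ 2 :=
          pow_le_pow_left₀ (by have := hspos j; positivity) (by rw [hs2]; linarith) 2
        have := mul_le_mul_of_nonneg_left hsq hc.le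
        simp only [empDev]
        linarith
      refine lt_of_lt_of_le ?_ hge
      have e1 : c * (s j / 2) ^ 2 = (c * 2 ^ j * D / 2) * (s j * a) := by
        rw [hs2]; ring
      rw [e1]
      refine mul_lt_mul_of_pos_right ?_ (mul_pos (hspos j) ha)
      have : 16 * (l + I) < c * 2 ^ j * D / 4 := by
        refine hD3.trans_le ?_
        have : c * D / 4 * 1 ≤ c * D / 4 * 2 ^ j := by gcongr
        linarith
      simp only [t]
      linarith
  have hmarkov : P {ω | l < avgDom lam G ζ n ω} ≤ ENNReal.ofReal (η / 2) := by
    refine (hζ.measure_average_gt_le hGi (fun z => by linarith [hB.nonneg (Wv lam z)]) hn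
      hl0).trans (ENNReal.ofReal_le_ofReal ?_)
    rw [div_le_iff₀ hl0, hl]
    have : η / 2 * (2 * (I + 1) / η) = I + 1 := by field_simp
    rw [this]
    linarith
  have hsum : P (⋃ j, bad j) ≤ ENNReal.ofReal (η / 2) := by
    calc P (⋃ j, bad j) ≤ ∑' j, P (bad j) := measure_iUnion_le _
      _ ≤ ∑' j, ENNReal.ofReal (8 * C₂ / (c * D) * (1 / 2) ^ j) := ENNReal.tsum_le_tsum hbad
      _ = ENNReal.ofReal (∑' j, 8 * C₂ / (c * D) * (1 / 2) ^ j) := by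
          rw [ENNReal.ofReal_tsum_of_nonneg (fun j => by positivity)
            (summable_geometric_two.mul_left _)]
      _ ≤ _ := by
          refine ENNReal.ofReal_le_ofReal ?_
          rw [tsum_mul_left, tsum_geometric_two]
          calc 8 * C₂ / (c * D) * 2 = 16 * C₂ / (c * D) := by ring
            _ ≤ η / 2 := hD4
  calc _ ≤ P ({ω | l < avgDom lam G ζ n ω} ∪ ⋃ j, bad j) := measure_mono hsub
    _ ≤ ENNReal.ofReal (η / 2) + ENNReal.ofReal (η / 2) :=
        (measure_union_le _ _).trans (add_le_add hmarkov hsum)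
    _ = ENNReal.ofReal η := by
        rw [← ENNReal.ofReal_add (by positivity) (by positivity), add_halves]

end Rate

section Sample

variable {B : ℕ} {Ω : Type*} {X : ℕ → Ω → E p} {ε : ℕ → Ω → ℝ} {U : ℕ → Ω → E p}
  {V : ℕ → Fin B → Ω → E p}

/-- The `i`-th observation of the `b`-th simulated set. -/
def simObs (X : ℕ → Ω → E p) (ε : ℕ → Ω → ℝ) (U : ℕ → Ω → E p) (V : ℕ → Fin B → Ω → E p)
    (b : Fin B) (i : ℕ) (ω : Ω) : (E p × ℝ) × E p × E p :=
  ((X i ω, ε i ω), U i ω, V i b ω)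

lemma IsSample.isIID [MeasurableSpace Ω] {P : Measure Ω} (hS : IsSample M P X ε U V) (b : Fin B) :
    IsIID P M.popLaw (simObs X ε U V b) := by
  have hmX := hS.measurable_X
  have hmε := hS.measurable_ε
  have hmU := hS.measurable_U
  have hmV := hS.measurable_V
  let π : (E p × ℝ) × E p × (Fin B → E p) → (E p × ℝ) × E p × E p :=
    Prod.map id (Prod.map id fun v => v b)
  have hπ : Measurable π := by fun_prop
  refine ⟨fun i => by unfold simObs; fun_prop, hS.indep.comp (fun _ => π) (fun _ => hπ),
    fun i => ?_⟩
  have hmeas : Measurable fun ω => ((X i ω, ε i ω), U i ω, fun b => V i b ω) :=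
    ((hmX i).prodMk (hmε i)).prodMk ((hmU i).prodMk (measurable_pi_lambda _ fun b => hmV i b))
  have e : simObs X ε U V b i = π ∘ fun ω => ((X i ω, ε i ω), U i ω, fun b => V i b ω) := rfl
  rw [e, ← Measure.map_map hπ hmeas, hS.law i]
  have h1 : MeasurePreserving (fun v : Fin B → E p => v b)
      (Measure.pi fun _ : Fin B => M.noise) M.noise := measurePreserving_eval _ b
  have h2 := (MeasurePreserving.id M.noise).prod h1
  exact ((MeasurePreserving.id M.lawXe).prod h2).map_eq

lemma Qn_eq_empObj (M : Model p q) (X : ℕ → Ω → E p) (ε : ℕ → Ω → ℝ) (U : ℕ → Ω → E p)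
    (V : ℕ → Fin B → Ω → E p) (lam h : ℝ) (n : ℕ) (b : Fin B) (ω : Ω) :
    Qn M X ε U V lam h n b ω = empObj M lam h (simObs X ε U V b) n ω := by
  ext θ
  simp only [Qn, empObj, kern, Kh, Yv, Wv, simObs, ← Finset.mul_sum]
  rw [one_div, mul_inv, mul_assoc]

end Sample

/-- For `h ≤ 1`, `n h³ ≥ n h⁵` tends to infinity, which is all that is taken from the growth
condition. The second summand of the rate alone already gives `n h³ a² ≥ 1`. -/
lemma C5.eventually_rate {h : ℕ → ℝ} (h5 : C5 h) :
    (∀ᶠ n : ℕ in atTop, h n ≤ 1 ∧ 0 < n ∧ 0 < h n ^ 2 + 1 / Real.sqrt (n * h n ^ 3) ∧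
      h n ^ 2 ≤ h n ^ 2 + 1 / Real.sqrt (n * h n ^ 3) ∧
      1 ≤ n * h n ^ 3 * (h n ^ 2 + 1 / Real.sqrt (n * h n ^ 3)) ^ 2) ∧
    Tendsto (fun n : ℕ => h n ^ 2 + 1 / Real.sqrt (n * h n ^ 3)) atTop (𝓝 0) := by
  obtain ⟨hpos, hlim, hinf⟩ := h5
  have hle : ∀ᶠ n in atTop, h n ≤ 1 := (hlim.eventually (gt_mem_nhds one_pos)).mono fun n => le_of_lt
  refine ⟨?_, ?_⟩
  · filter_upwards [hle, eventually_gt_atTop 0] with n hn hn0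
    have hh := hpos n
    have hn' : (0 : ℝ) < n := by exact_mod_cast hn0
    have hs : 0 < Real.sqrt (n * h n ^ 3) := Real.sqrt_pos.2 (by positivity)
    refine ⟨hn, hn0, by positivity, by linarith [one_div_pos.2 hs], ?_⟩
    calc (1 : ℝ) = n * h n ^ 3 * (1 / Real.sqrt (n * h n ^ 3)) ^ 2 := by
          rw [div_pow, one_pow, Real.sq_sqrt (by positivity)]
          field_simp
      _ ≤ _ := by
          gcongr
          linarith [sq_nonneg (h n)]
  · have h3 : Tendsto (fun n : ℕ => (n : ℝ) * h n ^ 3) atTop atTop := by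
      refine tendsto_atTop_mono' _ ?_ hinf
      filter_upwards [hle] with n hn
      have hh := hpos n
      exact mul_le_mul_of_nonneg_left (pow_le_pow_of_le_one hh.le hn (by norm_num))
        (Nat.cast_nonneg n)
    have h4 : Tendsto (fun n : ℕ => 1 / Real.sqrt (n * h n ^ 3)) atTop (𝓝 0) := by
      simp only [one_div]
      exact (Real.tendsto_sqrt_atTop.comp h3).inv_tendsto_atTop
    simpa using (hlim.pow 2).add h4

/-- The average can be far from the centre only if some summand is; each of the `B` events is
allotted probability `η / B`, so no independence across `b` is needed. -/
lemma IsBigOInProb.average {B : ℕ} {Ω : Type*} [MeasurableSpace Ω] {P : Measure Ω}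
    (hB : 0 < B) {θhat : Fin B → ℕ → Ω → E q} {θc : ℕ → E q} {a : ℕ → ℝ}
    (h : ∀ b, IsBigOInProb P (fun n ω => ‖θhat b n ω - θc n‖) a) :
    IsBigOInProb P (fun n ω => ‖((B : ℝ)⁻¹ • ∑ b, θhat b n ω) - θc n‖) a := by
  intro η hη
  have hB' : (0 : ℝ) < B := by exact_mod_cast hB
  choose D hD using fun b => h b (η / B) (by positivity)
  refine ⟨(B : ℝ)⁻¹ * ∑ b, D b, ?_⟩
  filter_upwards [eventually_all.2 hD] with n hn
  have hsub : {ω | ((B : ℝ)⁻¹ * ∑ b, D b) * a n <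
      |‖((B : ℝ)⁻¹ • ∑ b, θhat b n ω) - θc n‖|} ⊆
      ⋃ b, {ω | D b * a n < |‖θhat b n ω - θc n‖|} := by
    intro ω hω
    by_contra hcon
    simp only [Set.mem_iUnion, Set.mem_ofPred_eq, abs_norm, not_exists, not_lt] at hcon hω
    have e : ((B : ℝ)⁻¹ • ∑ b, θhat b n ω) - θc n = (B : ℝ)⁻¹ • ∑ b, (θhat b n ω - θc n) := by
      rw [Finset.sum_sub_distrib, smul_sub]
      congr 1
      simp only [Finset.sum_const, Finset.card_univ, Fintype.card_fin]
      rw [← Nat.cast_smul_eq_nsmul ℝ, smul_smul, inv_mul_cancel₀ hB'.ne', one_smul]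
    rw [e, norm_smul, norm_inv, Real.norm_of_nonneg hB'.le, mul_assoc] at hω
    have h2 : ‖∑ b, (θhat b n ω - θc n)‖ ≤ (∑ b, D b) * a n := by
      rw [Finset.sum_mul]
      exact (norm_sum_le _ _).trans (Finset.sum_le_sum fun b _ => hcon b)
    have := mul_le_mul_of_nonneg_left h2 (inv_pos.2 hB').le
    linarith
  calc _ ≤ P (⋃ b, {ω | D b * a n < |‖θhat b n ω - θc n‖|}) := measure_mono hsub
    _ ≤ ∑ b, P {ω | D b * a n < |‖θhat b n ω - θc n‖|} := measure_iUnion_fintype_le _ _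
    _ ≤ ∑ _b : Fin B, ENNReal.ofReal (η / B) := Finset.sum_le_sum fun b _ => hn b
    _ = ENNReal.ofReal η := by
        rw [Finset.sum_const, Finset.card_univ, Fintype.card_fin, nsmul_eq_mul,
          ← ENNReal.ofReal_natCast, ← ENNReal.ofReal_mul hB'.le, mul_div_cancel₀ _ hB'.ne']

/-- A local maximizer of the empirical objective that converges at the rate
`h² + (n h³)^(-1/2)`. -/
lemma exists_estimator {Ω : Type*} [MeasurableSpace Ω] {P : Measure Ω} [IsProbabilityMeasure P]
    {ζ : ℕ → Ω → (E p × ℝ) × E p × E p} (hζ : IsIID P M.popLaw ζ) {h : ℕ → ℝ}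
    {θh : ℝ → E q} (hθl : IsLimitArgmax M lam θl) (hdom : LocallyDominated M lam θl)
    (h1 : C1 M) (h2 : C2 M lam θl) (h3 : C3 M lam θl) (h4 : C4 M lam h θh) (h5 : C5 h) :
    ∃ θhat : ℕ → Ω → E q, (∀ n, Measurable (θhat n)) ∧
      Tendsto (fun n => P {ω | ¬ (θhat n ω ∈ M.Θ ∧
        IsLocalMax (empObj M lam (h n) ζ n ω) (θhat n ω))}) atTop (𝓝 0) ∧
      IsBigOInProb P (fun n ω => ‖θhat n ω - θh (h n)‖)
        (fun n => h n ^ 2 + 1 / Real.sqrt (n * h n ^ 3)) := by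
  obtain ⟨r, G, hB⟩ := exists_goodBall hθl.1 hdom
  obtain ⟨C, hC0, hC⟩ := exists_regularDens h2
  obtain ⟨c, hc, δ, hδ, hδr, hdrop⟩ := exists_popObj_drop h1 h3 hB hC0 hC hθl h4 h5
  have hθh := tendsto_smoothed_param h1 hC hθl h4 h5
  -- Then `5ρ < δ ≤ r`, as the peeling requires, and the closed ball lies where the quadratic drop
  -- holds.
  set ρ := δ / 6 with hρ
  have hρ0 : 0 < ρ := by positivity
  have hsub : Metric.closedBall θl ρ ⊆ Metric.ball θl δ :=
    Metric.closedBall_subset_ball (by linarith)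
  have hsub' : Metric.closedBall θl ρ ⊆ Metric.ball θl r :=
    hsub.trans (Metric.ball_subset_ball hδr)
  have hsel : ∀ n, ∃ s : Ω → E q, Measurable s ∧ ∀ ω, s ω ∈ Metric.closedBall θl ρ ∧
      ∀ y ∈ Metric.closedBall θl ρ,
        empObj M lam (h n) ζ n ω y ≤ empObj M lam (h n) ζ n ω (s ω) := by
    intro n
    refine exists_measurable_argmax (isCompact_closedBall θl ρ)
      ⟨θl, Metric.mem_closedBall_self hρ0.le⟩ (fun θ hθ => ?_) (fun ω => ?_)
    · refine (Finset.measurable_sum _ fun i _ => ?_).const_mul _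
      exact (measurable_kern h1 lam (h n) (hB.mem (hsub' hθ))).comp (hζ.measurable i)
    · refine (continuousOn_finsetSum _ fun i _ => ?_).const_smul ((n : ℝ)⁻¹)
      refine (continuous_Kh (h n)).comp_continuousOn (continuousOn_const.sub fun θ hθ => ?_)
      exact (hB.contDiffAt h1 _ (hsub' hθ)).continuousAt.continuousWithinAt
  choose θhat hmeas hmax using hsel
  obtain ⟨hrate, hlim⟩ := h5.eventually_rate
  have hnear : ∀ᶠ n in atTop, θh (h n) ∈ Metric.ball θl (ρ / 2) :=
    hθh.eventually (Metric.ball_mem_nhds θl (by positivity))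
  have hbig : ∀ η : ℝ, 0 < η → ∃ D : ℝ, ∀ᶠ n : ℕ in atTop,
      P {ω | D * (h n ^ 2 + 1 / Real.sqrt (n * h n ^ 3)) < ‖θhat n ω - θh (h n)‖} ≤
        ENNReal.ofReal η := by
    intro η hη
    obtain ⟨D, hD⟩ := hB.exists_rate h1 hC0 hC hζ hc (ρ := ρ) (by linarith) hη
    refine ⟨D, ?_⟩
    filter_upwards [hrate, hnear, hdrop] with n ⟨hn1, hn2, hn3, hn4, hn5⟩ hnb hnd
    have hmem : θh (h n) ∈ Metric.closedBall θl ρ :=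
      Metric.ball_subset_closedBall (Metric.ball_subset_ball (by linarith) hnb)
    refine (measure_mono fun ω hω => ?_).trans (hD (h n) n _ (θh (h n)) (h5.1 n) hn1 hn2 hn3 hn4
      hn5 hmem fun θ hθ => hnd θ (hsub hθ))
    exact ⟨θhat n ω, (hmax n ω).1, hω, (hmax n ω).2 _ hmem⟩
  refine ⟨θhat, hmeas, ?_, fun η hη => ?_⟩
  · rw [ENNReal.tendsto_nhds_zero]
    intro e he
    rcases eq_or_ne e ⊤ with rfl | hetop
    · exact Eventually.of_forall fun _ => le_top
    obtain ⟨D, hD⟩ := hbig e.toReal (ENNReal.toReal_pos he.ne' hetop)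
    have hDlim : Tendsto (fun n : ℕ => D * (h n ^ 2 + 1 / Real.sqrt (n * h n ^ 3))) atTop (𝓝 0) := by
      simpa using hlim.const_mul D
    filter_upwards [hD, hnear, hDlim.eventually (gt_mem_nhds (half_pos hρ0))] with n hn hnb hnD
    rw [ENNReal.ofReal_toReal hetop] at hn
    refine (measure_mono fun ω hω => ?_).trans hn
    by_contra hcon
    simp only [Set.mem_ofPred_eq, not_lt] at hcon hω
    refine hω ⟨hB.mem (hsub' (hmax n ω).1), ?_⟩
    -- Off the event of large deviation, both the estimation error and the distance from `θ(lam, h)`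
    -- to `θl` are at most `ρ / 2`, the latter strictly; so the maximizer over the closed ball is
    -- interior.
    have hin : θhat n ω ∈ Metric.ball θl ρ := by
      rw [mem_ball_iff_norm] at hnb ⊢
      have e : θhat n ω - θl = (θhat n ω - θh (h n)) + (θh (h n) - θl) := by abel
      rw [e]
      refine (norm_add_le _ _).trans_lt ?_
      linarith
    filter_upwards [Metric.isOpen_ball.mem_nhds hin] with y hy
    exact (hmax n ω).2 y (Metric.ball_subset_closedBall hy)
  · obtain ⟨D, hD⟩ := hbig η hη
    exact ⟨D, by simpa only [abs_norm] using hD⟩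

end

end SimexModal

theorem theorem2 {p q B : ℕ} (hB : 0 < B) (M : SimexModal.Model p q)
    {Ω : Type*} [MeasurableSpace Ω] (P : Measure Ω) [IsProbabilityMeasure P]
    (X : ℕ → Ω → SimexModal.E p) (ε : ℕ → Ω → ℝ) (U : ℕ → Ω → SimexModal.E p)
    (V : ℕ → Fin B → Ω → SimexModal.E p) (hS : SimexModal.IsSample M P X ε U V)
    (lam : ℝ) (hlam : 0 ≤ lam) (h : ℕ → ℝ)
    (θl : SimexModal.E q) (θh : ℝ → SimexModal.E q)
    (hθl : SimexModal.IsLimitArgmax M lam θl)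
    (hdom : SimexModal.LocallyDominated M lam θl)
    (h1 : SimexModal.C1 M) (h2 : SimexModal.C2 M lam θl) (h3 : SimexModal.C3 M lam θl)
    (h4 : SimexModal.C4 M lam h θh) (h5 : SimexModal.C5 h) :
    ∃ θhat : Fin B → ℕ → Ω → SimexModal.E q,
      (∀ b n, Measurable (θhat b n)) ∧
      (∀ b, Tendsto (fun n => P {ω | ¬ (θhat b n ω ∈ M.Θ ∧
        IsLocalMax (SimexModal.Qn M X ε U V lam (h n) n b ω) (θhat b n ω))}) atTop (𝓝 0)) ∧
      (∀ b, SimexModal.IsBigOInProb P (fun n ω => ‖θhat b n ω - θh (h n)‖)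
        (fun n => h n ^ 2 + 1 / Real.sqrt (n * h n ^ 3))) ∧
      SimexModal.IsBigOInProb P
        (fun n ω => ‖((B : ℝ)⁻¹ • ∑ b, θhat b n ω) - θh (h n)‖)
        (fun n => h n ^ 2 + 1 / Real.sqrt (n * h n ^ 3)) := by
  -- Each simulated set is, by itself, an i.i.d. sample from `popLaw`; that the sets share the same
  -- data plays no role.
  choose θhat hmeas hloc hrate using fun b : Fin B =>
    SimexModal.exists_estimator (hS.isIID b) hθl hdom h1 h2 h3 h4 h5
  refine ⟨θhat, hmeas, fun b => ?_, hrate, SimexModal.IsBigOInProb.average hB hrate⟩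
  simpa only [SimexModal.Qn_eq_empObj] using hloc b
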